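/- Let $F$ be a totally real number field with ring of integers $\mathcal O$, and let $B$ be a totally definite quaternion algebra over $F$. Let $R\subset B$ be an Eichler order (an intersection of two maximal orders) of (reduced) discriminant $\mathfrak D\subseteq\mathcal O$. Let $\mathfrak I(R)$ be the set of invertible (i.e. locally principal) left $R$-ideals; call $I,J\in\mathfrak I(R)$ equivalent if $I=Jx$ for some $x\in B^\times$, and let $M(R)$ (the space of quaternionic modular forms) be the complex vector space with basis the set of equivalence classes $[I]$. For a nonzero ideal $\mathfrak m\subseteq\mathcal O$ let $T_{\mathfrak m}$ be the linear operator on $M(R)$ given by $$T_{\mathfrak m}([I])=\sum_{J\in\mathfrak I(R),\ J\subseteq I,\ [I:J]=\mathfrak m^2}[J],$$ where $[I:J]$ is the index ideal of $J$ in $I$, i.e. the $\mathcal O$-submodule of $F$ generated by $\det\delta$ for all $F$-linear maps $\delta:B\to B$ with $\delta(I)\subseteq J$. A nonzero ideal $\mathfrak a\subseteq\mathcal O$ acts linearly on $M(R)$ by $\mathfrak a\cdot[I]=[\mathfrak a I]$. Let $\mathfrak m,\mathfrak n$ be nonzero integral ideals of $F$, and let $\mathfrak p$ be a nonzero prime ideal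 with $\mathfrak p\nmid\mathfrak D$, of norm $N(\mathfrak p)$. Then: 1. $T_{\mathfrak m}T_{\mathfrak n}=T_{\mathfrak m\mathfrak n}$ if $\mathfrak m$ and $\mathfrak n$ are coprime; 2. $T_{\mathfrak p^{k+2}}=T_{\mathfrak p^{k+1}}T_{\mathfrak p}-N(\mathfrak p)\,\mathfrak p\,T_{\mathfrak p^k}$ for every $k\ge 0$; 3. $T_{\mathfrak m}T_{\mathfrak p}=T_{\mathfrak m\mathfrak p}+N(\mathfrak p)\,\mathfrak p\,T_{\mathfrak m/\mathfrak p}$ if $\mathfrak p\mid\mathfrak m$. Relation (1) does not involve $\mathfrak p$, and holds also for ideals not prime to $\mathfrak D$. -/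

import Mathlib

open NumberField TensorProduct Quaternion

namespace QuatModForm

set_option linter.unusedSectionVars false

noncomputable section

universe u v

section General

variable (F : Type u) [Field F] [NumberField F] (B : Type v) [Ring B] [Algebra F B]

/-- `B` is a quaternion algebra over `F`: it has an `F`-basis `1, i, j, ij` with
`i² = a`, `j² = b`, `ij = -ji` for some `a, b ∈ Fˣ`. -/
def IsQuaternionAlgebra : Prop :=
  ∃ a b : F, a ≠ 0 ∧ b ≠ 0 ∧ Nonempty (B ≃ₐ[F] ℍ[F,a,b])

/-- `B` is ramified at the archimedean place `v`: the completion of `B` at `v`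
is a division ring. -/
def IsRamifiedAt (v : InfinitePlace F) : Prop :=
  ∀ x : v.Completion ⊗[F] B, x ≠ 0 → IsUnit x

/-- `B` is a totally definite quaternion algebra over the totally real field `F`. -/
structure IsTotallyDefinite : Prop where
  totallyReal : IsTotallyReal F
  quaternion : IsQuaternionAlgebra F B
  ramified : ∀ v : InfinitePlace F, IsRamifiedAt F B v

/-- The reduced trace of a quaternion algebra. The trace of multiplication by `x` on the
four-dimensional space `B` is twice the reduced trace of `x`. -/
def redTrace (x : B) : F := LinearMap.trace F B (LinearMap.mulLeft F x) / 2

end General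

variable {F : Type u} [Field F] [NumberField F] {B : Type v} [Ring B] [Algebra F B]

/-! ### Orders -/

/-- An order of `B`: a subring containing `𝓞 F` that is a full lattice. -/
def IsOrder (R : Subalgebra (𝓞 F) B) : Prop :=
  Submodule.IsLattice F (Subalgebra.toSubmodule R)

/-- A maximal order of `B`. -/
def IsMaximalOrder (R : Subalgebra (𝓞 F) B) : Prop :=
  IsOrder R ∧ ∀ R' : Subalgebra (𝓞 F) B, IsOrder R' → R ≤ R' → R' = R

/-- An Eichler order: the intersection of two maximal orders. -/
def IsEichlerOrder (R : Subalgebra (𝓞 F) B) : Prop :=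
  ∃ R₁ R₂ : Subalgebra (𝓞 F) B, IsMaximalOrder R₁ ∧ IsMaximalOrder R₂ ∧ R = R₁ ⊓ R₂

/-- The ideal `D` is the (reduced) discriminant of the order `R`: its square is the ideal
generated by the determinants `det (trd (xᵢ xⱼ))` for `x₁, …, x₄ ∈ R`. -/
def IsDiscriminant (R : Subalgebra (𝓞 F) B) (D : Ideal (𝓞 F)) : Prop :=
  Submodule.span (𝓞 F) {d : F | ∃ x : Fin 4 → B, (∀ i, x i ∈ R) ∧
      (Matrix.of fun i j => redTrace F B (x i * x j)).det = d}
    = IsLocalization.coeSubmodule F (D ^ 2)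

/-! ### Lattices, index, ideals -/

/-- The localization `I_𝔭 = {b | s b ∈ I for some s ∉ 𝔭}` inside `B`. -/
def locAt (𝔭 : Ideal (𝓞 F)) (I : Submodule (𝓞 F) B) : Set B :=
  {b | ∃ s : 𝓞 F, s ∉ 𝔭 ∧ s • b ∈ I}

/-- The index `[I : J]` of the lattice `J` in the lattice `I`, as a fractional ideal of `F`:
it is generated by the determinants of the `F`-linear maps of `B` carrying `I` into `J`. -/
def index (I J : Submodule (𝓞 F) B) : Submodule (𝓞 F) F :=
  Submodule.span (𝓞 F) {d : F | ∃ δ : B →ₗ[F] B, (∀ x ∈ I, δ x ∈ J) ∧ LinearMap.det δ = d}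

/-- The lattice `I x`, for `x ∈ Bˣ`. -/
def mulUnit (I : Submodule (𝓞 F) B) (x : Bˣ) : Submodule (𝓞 F) B :=
  I.map (LinearMap.mulRight (𝓞 F) (x : B))

/-- `I` is an invertible (i.e. locally principal) left `R`-ideal. -/
structure IsInvertibleLeftIdeal (R : Subalgebra (𝓞 F) B) (I : Submodule (𝓞 F) B) : Prop where
  isLattice : Submodule.IsLattice F I
  mul_mem : ∀ r ∈ R, ∀ b ∈ I, r * b ∈ I
  locallyPrincipal : ∀ 𝔭 : Ideal (𝓞 F), 𝔭.IsPrime → 𝔭 ≠ ⊥ →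
    ∃ x : Bˣ, locAt 𝔭 I = (fun b => b * (x : B)) '' locAt 𝔭 (Subalgebra.toSubmodule R)

/-- The set of invertible left `R`-ideals. -/
def LeftIdeals (R : Subalgebra (𝓞 F) B) : Type v :=
  {I : Submodule (𝓞 F) B // IsInvertibleLeftIdeal R I}

theorem mem_mulUnit {I : Submodule (𝓞 F) B} {x : Bˣ} {b : B} :
    b ∈ mulUnit I x ↔ b * ((x⁻¹ : Bˣ) : B) ∈ I := by
  constructor
  · rintro ⟨c, hc, rfl⟩
    simpa using hc
  · intro h
    exact ⟨_, h, by simp⟩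

theorem mulUnit_one (I : Submodule (𝓞 F) B) : mulUnit I 1 = I := by
  ext b; simp [mem_mulUnit]

theorem mulUnit_mul (I : Submodule (𝓞 F) B) (x y : Bˣ) :
    mulUnit (mulUnit I x) y = mulUnit I (x * y) := by
  ext b; simp [mem_mulUnit, mul_assoc]

theorem mulUnit_mono {I J : Submodule (𝓞 F) B} (h : J ≤ I) (x : Bˣ) :
    mulUnit J x ≤ mulUnit I x := Submodule.map_mono h

theorem IsInvertibleLeftIdeal.mulUnit {R : Subalgebra (𝓞 F) B} {I : Submodule (𝓞 F) B}
    (h : IsInvertibleLeftIdeal R I) (x : Bˣ) : IsInvertibleLeftIdeal R (mulUnit I x) where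
  isLattice := by
    refine ⟨h.isLattice.fg.map _, ?_⟩
    have h2 : (QuatModForm.mulUnit I x : Set B)
        = (LinearMap.mulRight F (x : B)) '' (I : Set B) := rfl
    rw [h2, Submodule.span_image, h.isLattice.span_eq_top, Submodule.map_top,
      LinearMap.range_eq_top]
    exact fun b => ⟨b * ((x⁻¹ : Bˣ) : B), by simp⟩
  mul_mem r hr b hb := by
    rw [mem_mulUnit] at hb ⊢
    rw [mul_assoc]
    exact h.mul_mem r hr _ hb
  locallyPrincipal 𝔭 h𝔭 h0 := by
    obtain ⟨y, hy⟩ := h.locallyPrincipal 𝔭 h𝔭 h0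
    refine ⟨y * x, ?_⟩
    have h1 : locAt 𝔭 (QuatModForm.mulUnit I x) = (fun b => b * (x : B)) '' locAt 𝔭 I := by
      ext b
      constructor
      · rintro ⟨s, hs, hb⟩
        rw [mem_mulUnit, smul_mul_assoc] at hb
        exact ⟨_, ⟨s, hs, hb⟩, by simp⟩
      · rintro ⟨c, ⟨s, hs, hc⟩, rfl⟩
        exact ⟨s, hs, by rw [mem_mulUnit]; simpa using hc⟩
    rw [h1, hy, Set.image_image]
    simp [mul_assoc]

/-- The ideal `I x`, for an invertible left `R`-ideal `I` and `x ∈ Bˣ`. -/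
def LeftIdeals.mulUnit {R : Subalgebra (𝓞 F) B} (I : LeftIdeals R) (x : Bˣ) : LeftIdeals R :=
  ⟨QuatModForm.mulUnit I.1 x, I.2.mulUnit x⟩

/-- `I` and `J` are equivalent when `I = J x` for some `x ∈ Bˣ`. -/
instance leftIdealSetoid (R : Subalgebra (𝓞 F) B) : Setoid (LeftIdeals R) where
  r I J := ∃ x : Bˣ, I = J.mulUnit x
  iseqv :=
    { refl := fun I => ⟨1, Subtype.ext (mulUnit_one I.1).symm⟩
      symm := by
        rintro I J ⟨x, rfl⟩
        exact ⟨x⁻¹, Subtype.ext (by simp [LeftIdeals.mulUnit, mulUnit_mul, mulUnit_one])⟩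
      trans := by
        rintro I J K ⟨x, rfl⟩ ⟨y, rfl⟩
        exact ⟨y * x, Subtype.ext (by simp [LeftIdeals.mulUnit, mulUnit_mul])⟩ }

/-- The set `cl(R)` of classes of invertible left `R`-ideals. -/
def Cl (R : Subalgebra (𝓞 F) B) : Type v := Quotient (leftIdealSetoid R)

/-- The class `[I]`. -/
def LeftIdeals.cl {R : Subalgebra (𝓞 F) B} (I : LeftIdeals R) : Cl R :=
  Quotient.mk (leftIdealSetoid R) I

theorem LeftIdeals.cl_mulUnit {R : Subalgebra (𝓞 F) B} (I : LeftIdeals R) (x : Bˣ) :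
    (I.mulUnit x).cl = I.cl := Quotient.sound ⟨x, rfl⟩

/-- The space `M(R)` of quaternionic modular forms: the complex vector space with basis
`cl(R)`. -/
abbrev M (R : Subalgebra (𝓞 F) B) : Type v := Cl R →₀ ℂ

/-! ### Hecke operators -/

/-- The set `t_𝔪(I)` of `J ⊆ I` with `[I : J] = 𝔪²`. -/
def heckeSet {R : Subalgebra (𝓞 F) B} (𝔪 : Ideal (𝓞 F)) (I : LeftIdeals R) :
    Set (LeftIdeals R) :=
  {J | J.1 ≤ I.1 ∧ index I.1 J.1 = IsLocalization.coeSubmodule F (𝔪 ^ 2)}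

theorem index_mulUnit_le (I J : Submodule (𝓞 F) B) (x : Bˣ) :
    index I J ≤ index (mulUnit I x) (mulUnit J x) := by
  refine Submodule.span_mono ?_
  rintro d ⟨δ, hδ, rfl⟩
  let e : B ≃ₗ[F] B := LinearEquiv.ofLinearMap (LinearMap.mulRight F (x : B))
    (LinearMap.mulRight F ((x⁻¹ : Bˣ) : B)) (by ext; simp) (by ext; simp)
  refine ⟨(e : B →ₗ[F] B) ∘ₗ δ ∘ₗ (e.symm : B →ₗ[F] B), ?_, LinearMap.det_conj δ e⟩
  intro b hb
  rw [mem_mulUnit] at hb ⊢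
  simpa [e] using hδ _ hb

theorem index_mulUnit (I J : Submodule (𝓞 F) B) (x : Bˣ) :
    index (mulUnit I x) (mulUnit J x) = index I J := by
  refine le_antisymm ?_ (index_mulUnit_le I J x)
  simpa [mulUnit_mul, mulUnit_one] using index_mulUnit_le (mulUnit I x) (mulUnit J x) x⁻¹

theorem heckeSet_mulUnit {R : Subalgebra (𝓞 F) B} {𝔪 : Ideal (𝓞 F)} {I J : LeftIdeals R}
    (x : Bˣ) (h : J ∈ heckeSet 𝔪 I) : J.mulUnit x ∈ heckeSet 𝔪 (I.mulUnit x) :=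
  ⟨mulUnit_mono h.1 x, (index_mulUnit I.1 J.1 x).trans h.2⟩

theorem bijOn_heckeSet {R : Subalgebra (𝓞 F) B} (𝔪 : Ideal (𝓞 F)) (I : LeftIdeals R)
    (x : Bˣ) :
    Set.BijOn (fun J => J.mulUnit x) (heckeSet 𝔪 I) (heckeSet 𝔪 (I.mulUnit x)) := by
  have key : ∀ (K : LeftIdeals R) (y z : Bˣ), y * z = 1 → (K.mulUnit y).mulUnit z = K := by
    intro K y z h
    exact Subtype.ext (by simp [LeftIdeals.mulUnit, mulUnit_mul, mulUnit_one, h])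
  refine ⟨fun J hJ => heckeSet_mulUnit x hJ, ?_, ?_⟩
  · intro J _ K _ h
    have h' : J.mulUnit x = K.mulUnit x := h
    rw [← key J x x⁻¹ (by simp), h', key K x x⁻¹ (by simp)]
  · intro J hJ
    refine ⟨J.mulUnit x⁻¹, ?_, key J x⁻¹ x (by simp)⟩
    have := heckeSet_mulUnit x⁻¹ hJ
    rwa [key I x x⁻¹ (by simp)] at this

theorem exists_algebraMap_eq_charpoly_coeff {I : Submodule (𝓞 F) B}
    (hI : Submodule.IsLattice F I) [Module.Finite F B] (δ : B →ₗ[F] B)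
    (hδ : ∀ x ∈ I, δ x ∈ I) (n : ℕ) : ∃ a : 𝓞 F, (a : F) = δ.charpoly.coeff n := by
  classical
  have hfin : Module.Finite (𝓞 F) I := Module.Finite.iff_fg.2 hI.fg
  let f : I →ₗ[𝓞 F] I := (δ.restrictScalars (𝓞 F)).restrict hδ
  obtain ⟨q, hq, hqf⟩ := LinearMap.exists_monic_and_aeval_eq_zero (𝓞 F) f
  have hpow : ∀ (k : ℕ) (x : I), (((f ^ k) x : I) : B) = (δ ^ k) (x : B) := by
    intro k
    induction k with
    | zero => intro x; rfl
    | succ k ih => intro x; rw [pow_succ, pow_succ]; exact ih (f x)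
  have hqδ : Polynomial.aeval δ (q.map (algebraMap (𝓞 F) F)) = 0 := by
    have h1 : ∀ x : I, Polynomial.aeval δ (q.map (algebraMap (𝓞 F) F)) (x : B) = 0 := by
      intro x
      have h2 : ((Polynomial.aeval f q x : I) : B) = 0 := by rw [hqf]; rfl
      rw [← h2, Polynomial.aeval_eq_sum_range, Polynomial.aeval_eq_sum_range,
        hq.natDegree_map (algebraMap (𝓞 F) F)]
      simp [LinearMap.sum_apply, hpow, algebraMap_smul]
    have h3 : Submodule.span F (I : Set B)
        ≤ LinearMap.ker (Polynomial.aeval δ (q.map (algebraMap (𝓞 F) F))) :=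
      Submodule.span_le.2 fun x hx => h1 ⟨x, hx⟩
    rw [hI.span_eq_top] at h3
    exact LinearMap.ker_eq_top.1 (top_le_iff.1 h3)
  let Ω := AlgebraicClosure F
  have hint : IsIntegral (𝓞 F) (δ.charpoly.coeff n) := by
    let b := Module.finBasis F B
    let φ : Module.End F B →ₐ[F] Matrix (Fin (Module.finrank F B)) (Fin (Module.finrank F B)) Ω :=
      (Algebra.ofId F Ω).mapMatrix.comp (LinearMap.toMatrixAlgEquiv b).toAlgHom
    have hchar : (φ δ).charpoly = δ.charpoly.map (algebraMap F Ω) := by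
      rw [← LinearMap.charpoly_toMatrix δ b, ← Matrix.charpoly_map]
      rfl
    have hroot : ∀ r : Ω, (φ δ).charpoly.IsRoot r → IsIntegral (𝓞 F) r := by
      intro r hr
      refine ⟨q, hq, ?_⟩
      have h4 : Polynomial.aeval (φ δ) ((q.map (algebraMap (𝓞 F) F)).map (algebraMap F Ω)) = 0 := by
        rw [Polynomial.aeval_map_algebraMap, Polynomial.aeval_algHom_apply, hqδ, map_zero]
      have h5 := spectrum.subset_polynomial_aeval (φ δ)
        ((q.map (algebraMap (𝓞 F) F)).map (algebraMap F Ω))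
        ⟨r, Matrix.mem_spectrum_of_isRoot_charpoly hr, rfl⟩
      have : Nonempty (Fin (Module.finrank F B)) := by
        by_contra hempty
        rw [not_nonempty_iff] at hempty
        rw [Matrix.charpoly, Matrix.det_isEmpty] at hr
        simp at hr
      rw [h4, spectrum.zero_eq, Set.mem_singleton_iff] at h5
      rw [Polynomial.map_map, ← IsScalarTower.algebraMap_eq] at h5
      rw [← Polynomial.eval_map]
      exact h5
    rw [← isIntegral_algebraMap_iff (FaithfulSMul.algebraMap_injective F Ω),
      ← Polynomial.coeff_map, ← hchar]
    exact Polynomial.isIntegral_coeff_of_factors _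
      (by rw [(Matrix.charpoly_monic _).leadingCoeff]; exact isIntegral_one)
      (IsAlgClosed.splits _) hroot n
  exact IsIntegrallyClosed.isIntegral_iff.1 hint

/-- If `δ` carries the lattice `I` into `J ⊆ I` then `det δ` multiplies `I` into `J`. -/
theorem det_smul_mem {I J : Submodule (𝓞 F) B} (hI : Submodule.IsLattice F I)
    [Module.Finite F B] (hJ : J ≤ I) (δ : B →ₗ[F] B) (hδ : ∀ x ∈ I, δ x ∈ J) :
    ∀ x ∈ I, LinearMap.det δ • x ∈ J := by
  have hδI : ∀ x ∈ I, δ x ∈ I := fun x hx => hJ (hδ x hx)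
  have hpow : ∀ k : ℕ, ∀ x ∈ I, (δ ^ k) x ∈ I := by
    intro k
    induction k with
    | zero => intro x hx; exact hx
    | succ k ih => intro x hx; rw [pow_succ]; exact ih _ (hδI x hx)
  intro x hx
  have h0 : δ.charpoly.coeff 0 • x ∈ J := by
    have h1 := LinearMap.congr_fun (LinearMap.aeval_self_charpoly δ) x
    rw [← Polynomial.X_mul_divX_add δ.charpoly, map_add, map_mul, Polynomial.aeval_X,
      Polynomial.aeval_C] at h1
    have h2 : δ.charpoly.coeff 0 • x = -δ (Polynomial.aeval δ δ.charpoly.divX x) := by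
      rw [eq_neg_iff_add_eq_zero, add_comm]
      exact h1
    rw [h2]
    refine J.neg_mem (hδ _ ?_)
    rw [Polynomial.aeval_eq_sum_range, LinearMap.sum_apply]
    refine I.sum_mem fun k _ => ?_
    obtain ⟨a, ha⟩ := exists_algebraMap_eq_charpoly_coeff hI δ hδI (k + 1)
    rw [Polynomial.coeff_divX, ← ha, LinearMap.smul_apply]
    have h3 := I.smul_mem a (hpow k x hx)
    rwa [← algebraMap_smul F a] at h3
  rw [LinearMap.det_eq_sign_charpoly_coeff, mul_smul]
  rcases neg_one_pow_eq_or F (Module.finrank F B) with h | h <;> rw [h]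
  · rwa [one_smul]
  · rw [neg_one_smul]
    exact J.neg_mem h0

/-- The sets `t_𝔪(I)` are finite. -/
theorem heckeSet_finite [Module.Finite F B] {R : Subalgebra (𝓞 F) B} {𝔪 : Ideal (𝓞 F)}
    (h𝔪 : 𝔪 ≠ ⊥) (I : LeftIdeals R) : (heckeSet 𝔪 I).Finite := by
  have hsq : 𝔪 ^ 2 ≠ ⊥ := pow_ne_zero 2 h𝔪
  have hfin : Module.Finite (𝓞 F) I.1 := Module.Finite.iff_fg.2 I.2.isLattice.fg
  have hq : Finite (𝓞 F ⧸ 𝔪 ^ 2) := Ideal.finiteQuotientOfFreeOfNeBot _ hsq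
  let N : Submodule (𝓞 F) I.1 := (𝔪 ^ 2) • ⊤
  have hN : Finite (I.1 ⧸ N) := by
    have : Finite (I.1 ⧸ (⊤ : Submodule (𝓞 F) I.1)) := inferInstance
    exact Submodule.finite_quotient_smul _ hfin.fg_top
  have hle : ∀ J ∈ heckeSet 𝔪 I, N ≤ J.1.comap I.1.subtype := by
    intro J hJ
    refine Submodule.smul_le.2 fun c hc x _ => ?_
    have hc' : (c : F) ∈ index I.1 J.1 := by
      rw [hJ.2]
      exact ⟨c, hc, rfl⟩
    have h1 : ∀ d ∈ index I.1 J.1, d • (x : B) ∈ J.1 := by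
      intro d hd
      refine Submodule.span_induction ?_ ?_ ?_ ?_ hd
      · rintro _ ⟨δ, hδ, rfl⟩
        exact det_smul_mem I.2.isLattice hJ.1 δ hδ x x.2
      · simp
      · intro d e _ _ hd he
        rw [add_smul]
        exact add_mem hd he
      · intro a d _ hd
        rw [smul_assoc]
        exact J.1.smul_mem a hd
    have h2 := h1 _ hc'
    rw [Submodule.mem_comap]
    change c • (x : B) ∈ J.1
    rwa [← algebraMap_smul F c]
  refine Set.Finite.of_finite_image (f := fun J => (J.1.comap I.1.subtype).map N.mkQ)
    (Set.toFinite _) ?_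
  intro J hJ K hK h
  have h1 : J.1.comap I.1.subtype = K.1.comap I.1.subtype := by
    have h2 := congrArg (Submodule.comap N.mkQ) h
    simp only [Submodule.comap_map_mkQ] at h2
    rwa [sup_eq_right.2 (hle J hJ), sup_eq_right.2 (hle K hK)] at h2
  refine Subtype.ext (le_antisymm (fun x hx => ?_) (fun x hx => ?_))
  · have h3 : (⟨x, hJ.1 hx⟩ : I.1) ∈ J.1.comap I.1.subtype := hx
    rw [h1] at h3
    exact h3
  · have h3 : (⟨x, hK.1 hx⟩ : I.1) ∈ K.1.comap I.1.subtype := hx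
    rw [← h1] at h3
    exact h3

/-- The sum `∑ [J]` over `J ∈ t_𝔪(I)`; for `𝔪 ≠ 0` this is a finite sum by
`heckeSet_finite` below. -/
def heckeSum {R : Subalgebra (𝓞 F) B} (𝔪 : Ideal (𝓞 F)) (I : LeftIdeals R) : M R :=
  ∑ᶠ J ∈ heckeSet 𝔪 I, Finsupp.single J.cl (1 : ℂ)

theorem heckeSum_mulUnit {R : Subalgebra (𝓞 F) B} (𝔪 : Ideal (𝓞 F)) (I : LeftIdeals R)
    (x : Bˣ) : heckeSum 𝔪 (I.mulUnit x) = heckeSum 𝔪 I := by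
  symm
  refine finsum_mem_eq_of_bijOn _ (bijOn_heckeSet 𝔪 I x) fun J _ => ?_
  rw [LeftIdeals.cl_mulUnit]

/-- The sum `∑ [J]` over `J ∈ t_𝔪(I)`, as a function of the class `[I]`. -/
def heckeSumCl (R : Subalgebra (𝓞 F) B) (𝔪 : Ideal (𝓞 F)) : Cl R → M R :=
  Quotient.lift (heckeSum (R := R) 𝔪) (by
    rintro I J ⟨x, rfl⟩
    exact heckeSum_mulUnit 𝔪 J x)

/-- The Hecke operator `T_𝔪` on `M(R)`: the linear map with `T_𝔪([I]) = ∑_{J ∈ t_𝔪(I)} [J]`. -/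
def hecke (R : Subalgebra (𝓞 F) B) (𝔪 : Ideal (𝓞 F)) : Module.End ℂ (M R) :=
  Finsupp.linearCombination ℂ (heckeSumCl R 𝔪)

theorem hecke_cl [Module.Finite F B] (R : Subalgebra (𝓞 F) B) {𝔪 : Ideal (𝓞 F)} (h𝔪 : 𝔪 ≠ ⊥)
    (I : LeftIdeals R) : hecke R 𝔪 (Finsupp.single I.cl 1)
      = ∑ J ∈ (heckeSet_finite h𝔪 I).toFinset, Finsupp.single J.cl 1 := by
  rw [hecke, Finsupp.linearCombination_single, one_smul]
  exact finsum_mem_eq_finite_toFinset_sum _ _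

/-! ### Action of the ideals of `F` -/

theorem ideal_locally_principal {𝔞 𝔭 : Ideal (𝓞 F)} (h𝔞 : 𝔞 ≠ ⊥) (h𝔭 : 𝔭.IsPrime) :
    ∃ ξ ∈ 𝔞, ξ ≠ 0 ∧ ∀ α ∈ 𝔞, ∃ s : 𝓞 F, s ∉ 𝔭 ∧ ∃ t : 𝓞 F, s * α = t * ξ := by
  have hne : ¬ 𝔞 ≤ 𝔞 * 𝔭 := by
    intro hle
    have h1 : 𝔞 * 𝔭 = 𝔞 * 1 := by
      rw [mul_one]
      exact le_antisymm Ideal.mul_le_left hle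
    exact h𝔭.ne_top ((mul_left_cancel₀ h𝔞 h1).trans Ideal.one_eq_top)
  obtain ⟨ξ, hξ, hξ'⟩ := SetLike.not_le_iff_exists.1 hne
  obtain ⟨𝔠, h𝔠⟩ := Ideal.dvd_iff_le.2 ((Ideal.span_singleton_le_iff_mem (I := 𝔞)).2 hξ)
  have hc : ¬ 𝔠 ≤ 𝔭 := by
    intro hle
    refine hξ' (Ideal.mul_mono_right hle ?_)
    rw [← h𝔠]
    exact Ideal.mem_span_singleton_self ξ
  obtain ⟨s, hs, hs'⟩ := SetLike.not_le_iff_exists.1 hc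
  refine ⟨ξ, hξ, fun h0 => hξ' (h0 ▸ zero_mem _), fun α hα => ⟨s, hs', ?_⟩⟩
  have h2 : s * α ∈ Ideal.span {ξ} := by
    rw [h𝔠, mul_comm s α]
    exact Ideal.mul_mem_mul hα hs
  obtain ⟨t, ht⟩ := Ideal.mem_span_singleton'.1 h2
  exact ⟨t, ht.symm⟩

theorem IsInvertibleLeftIdeal.smul {R : Subalgebra (𝓞 F) B} {I : Submodule (𝓞 F) B}
    (h : IsInvertibleLeftIdeal R I) {𝔞 : Ideal (𝓞 F)} (h𝔞 : 𝔞 ≠ ⊥) :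
    IsInvertibleLeftIdeal R (𝔞 • I) where
  isLattice := by
    obtain ⟨c, hc, hc0⟩ := Submodule.exists_mem_ne_zero_of_ne_bot h𝔞
    refine ⟨Submodule.FG.smul ((isNoetherianRing_iff_ideal_fg _).1 inferInstance 𝔞)
      h.isLattice.fg, ?_⟩
    rw [eq_top_iff, ← h.isLattice.span_eq_top, Submodule.span_le]
    intro b hb
    have h1 : c • b ∈ Submodule.span F ((𝔞 • I : Submodule (𝓞 F) B) : Set B) :=
      Submodule.subset_span (Submodule.smul_mem_smul hc hb)
    have hc1 : (c : F) ≠ 0 := by simpa using hc0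
    have h2 := Submodule.smul_mem _ ((c : F)⁻¹) h1
    rwa [← algebraMap_smul F c b, smul_smul, inv_mul_cancel₀ hc1, one_smul] at h2
  mul_mem r hr b hb := by
    refine Submodule.smul_induction_on hb ?_ ?_
    · intro a ha c hc
      rw [mul_smul_comm]
      exact Submodule.smul_mem_smul ha (h.mul_mem r hr c hc)
    · intro c d hc hd
      rw [mul_add]
      exact add_mem hc hd
  locallyPrincipal 𝔭 h𝔭 h0 := by
    obtain ⟨y, hy⟩ := h.locallyPrincipal 𝔭 h𝔭 h0
    obtain ⟨ξ, hξ, hξ0, hloc⟩ := ideal_locally_principal h𝔞 h𝔭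
    have hξ1 : (ξ : F) ≠ 0 := by simpa using hξ0
    let z : Bˣ := Units.map (algebraMap F B : F →* B) (Units.mk0 (ξ : F) hξ1)
    have hz : ∀ b : B, b * (z : B) = ξ • b := by
      intro b
      rw [← algebraMap_smul F ξ b, Algebra.smul_def, Algebra.commutes]
      rfl
    refine ⟨y * z, ?_⟩
    have h1 : locAt 𝔭 (𝔞 • I) = (fun b => b * (z : B)) '' locAt 𝔭 I := by
      ext b
      constructor
      · rintro ⟨s, hs, hb⟩
        have h2 : ∃ t : 𝓞 F, t ∉ 𝔭 ∧ ∃ c ∈ I, t • (s • b) = ξ • c := by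
          refine Submodule.smul_induction_on hb ?_ ?_
          · intro a ha c hc
            obtain ⟨t, ht, r, hr⟩ := hloc a ha
            refine ⟨t, ht, r • c, I.smul_mem r hc, ?_⟩
            rw [smul_smul, hr, smul_smul, mul_comm]
          · rintro c d ⟨t, ht, c', hc', h1⟩ ⟨u, hu, d', hd', h2⟩
            refine ⟨t * u, fun h => (h𝔭.mem_or_mem h).elim ht hu, u • c' + t • d',
              add_mem (I.smul_mem u hc') (I.smul_mem t hd'), ?_⟩
            rw [smul_add, smul_add, mul_comm t u, mul_smul, h1, mul_comm u t, mul_smul, h2]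
            rw [smul_comm u, smul_comm t]
        obtain ⟨t, ht, c, hc, h3⟩ := h2
        refine ⟨b * ((z⁻¹ : Bˣ) : B), ⟨t * s, fun h => (h𝔭.mem_or_mem h).elim ht hs, ?_⟩,
          by simp⟩
        rw [← smul_mul_assoc, mul_smul, h3, ← hz]
        simpa using hc
      · rintro ⟨c, ⟨s, hs, hc⟩, rfl⟩
        refine ⟨s, hs, ?_⟩
        change s • (c * (z : B)) ∈ _
        rw [hz, smul_comm]
        exact Submodule.smul_mem_smul hξ hc
    rw [h1, hy, Set.image_image]
    simp [mul_assoc]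

/-- The ideal `𝔞 I`. -/
def LeftIdeals.idealMul {R : Subalgebra (𝓞 F) B} (𝔞 : Ideal (𝓞 F)) (h𝔞 : 𝔞 ≠ ⊥)
    (I : LeftIdeals R) : LeftIdeals R :=
  ⟨𝔞 • I.1, I.2.smul h𝔞⟩

theorem LeftIdeals.idealMul_mulUnit {R : Subalgebra (𝓞 F) B} (𝔞 : Ideal (𝓞 F)) (h𝔞 : 𝔞 ≠ ⊥)
    (I : LeftIdeals R) (x : Bˣ) :
    (I.mulUnit x).idealMul 𝔞 h𝔞 = (I.idealMul 𝔞 h𝔞).mulUnit x :=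
  Subtype.ext (Submodule.map_smul'' 𝔞 I.1 _).symm

/-- The map `[I] ↦ [𝔞 I]` on `cl(R)`. -/
def idealMulCl (R : Subalgebra (𝓞 F) B) (𝔞 : Ideal (𝓞 F)) (h𝔞 : 𝔞 ≠ ⊥) : Cl R → Cl R :=
  Quotient.lift (fun I : LeftIdeals R => (I.idealMul 𝔞 h𝔞).cl) (by
    rintro I J ⟨x, rfl⟩
    rw [LeftIdeals.idealMul_mulUnit, LeftIdeals.cl_mulUnit])

/-- The action of a nonzero ideal `𝔞` of `𝓞 F` on `M(R)`: the linear map `[I] ↦ [𝔞 I]`. -/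
def idealAct (R : Subalgebra (𝓞 F) B) (𝔞 : Ideal (𝓞 F)) (h𝔞 : 𝔞 ≠ ⊥) :
    Module.End ℂ (M R) :=
  Finsupp.lmapDomain ℂ ℂ (idealMulCl R 𝔞 h𝔞)

theorem idealAct_cl (R : Subalgebra (𝓞 F) B) (𝔞 : Ideal (𝓞 F)) (h𝔞 : 𝔞 ≠ ⊥)
    (I : LeftIdeals R) : idealAct R 𝔞 h𝔞 (Finsupp.single I.cl 1)
      = Finsupp.single (I.idealMul 𝔞 h𝔞).cl 1 := by
  rw [idealAct, Finsupp.lmapDomain_apply, Finsupp.mapDomain_single]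
  rfl

end

end QuatModForm

namespace QuatModForm

open IsDedekindDomain

set_option linter.unusedSectionVars false

variable {F : Type*} [Field F] [NumberField F]

/-! ### Localization at a prime -/

section Localization

variable {V W : Type*} [AddCommGroup V] [Module (𝓞 F) V] [AddCommGroup W] [Module (𝓞 F) W]

/-! Everything is a count of intermediate ideals. Indices multiply in towers, so the coefficient of
`[K]` in the product of the operators for `𝔪` and `𝔫` at `[I]` is the number of `J ∈ t_𝔫(I)` with `K
⊆ J`, for `K ∈ t_𝔪𝔫(I)` (`hecke_mul_hecke_cl`). For coprime ideals, `J = K + 𝔫²I` is the only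
possibility (`numBetween_of_isCoprime`).

At a prime `𝔭` not dividing the discriminant, the members of `t_𝔭(I)` are exactly the left
`R`-modules strictly between `𝔭I` and `I` (`exists_mem_heckeSet_of_between`,
`smul_le_of_mem_heckeSet`, `ne_of_mem_heckeSet`). If `K` is not inside `𝔭I`, then `K + 𝔭I` is the
only member containing `K`. If `K ⊆ 𝔭I`, all members contain `K`, and there are `N(𝔭) + 1` of them
(`ncard_heckeSet_prime`). Since `[I : 𝔭I] = 𝔭⁴`, the `K ∈ t_𝔪𝔭𝔭(I)` inside `𝔭I` form `t_𝔪(𝔭I)`; the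
`N(𝔭)` surplus choices for these give the correction term (`hecke_mul_hecke_prime`), and both
relations at `𝔭` are instances of this.

The hypothesis on `𝔭` provides four elements of `R` whose Gram determinant is prime to `𝔭`, so the
trace form is nondegenerate on `R/𝔭R`. This drives two arguments. First, the norm form on `I/𝔭I` is
nondegenerate, so an intermediate module contains an element of relative norm exactly divisible by
`𝔭`, and that element is a local generator. Second, Chevalley–Warning gives an isotropic vector of
trace zero, hence `u, w` with `u² = 0` and `uw + wu = 1` modulo `𝔭` (`exists_matrix_units`). Stable
subspaces of the four-dimensional space `I/𝔭I` are determined by their intersection with the plane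
`ker u`, so intermediate modules correspond to lines in that plane.

Local arguments stay inside `B`: a statement at `v` is a statement up to a multiplier outside `v`.
-/

theorem mem_of_forall_locally_mem {I : Submodule (𝓞 F) V} {b : V}
    (h : ∀ v : HeightOneSpectrum (𝓞 F), ∃ s ∉ v.asIdeal, s • b ∈ I) : b ∈ I := by
  by_contra hb
  -- The ideal of multipliers carrying `b` into `I`; if proper, it lies in a maximal ideal, against
  -- the hypothesis there.
  let 𝔠 : Ideal (𝓞 F) := I.comap (LinearMap.toSpanSingleton (𝓞 F) V b)
  have hc : 𝔠 ≠ ⊤ := fun h1 => hb (by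
    have : (1 : 𝓞 F) ∈ 𝔠 := h1 ▸ Submodule.mem_top
    simpa [𝔠] using this)
  obtain ⟨M, hM, hcM⟩ := Ideal.exists_le_maximal 𝔠 hc
  obtain ⟨s, hs, hsb⟩ := h ⟨M, hM.isPrime, Ring.ne_bot_of_isMaximal_of_not_isField hM
    (RingOfIntegers.not_isField F)⟩
  exact hs (hcM (by simpa [𝔠] using hsb))

/-- Finite generation: the product of the multipliers of the generators serves all of `I`, and it
avoids `v` because `v` is prime. -/
theorem exists_common_multiplier (v : HeightOneSpectrum (𝓞 F)) {I : Submodule (𝓞 F) V}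
    (hI : I.FG) (J : Submodule (𝓞 F) W) (f : V →ₗ[𝓞 F] W)
    (h : ∀ b ∈ I, ∃ t ∉ v.asIdeal, t • f b ∈ J) :
    ∃ t ∉ v.asIdeal, ∀ b ∈ I, t • f b ∈ J := by
  obtain ⟨S, rfl⟩ := hI
  choose! t ht htJ using fun b (hb : b ∈ (S : Set V)) => h b (Submodule.subset_span hb)
  refine ⟨∏ b ∈ S, t b, fun hmem => ?_, fun b hb => ?_⟩
  · obtain ⟨b, hb, hbt⟩ := (v.isPrime.prod_mem_iff).1 hmem
    exact ht b hb hbt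
  · have hle : Submodule.span (𝓞 F) (S : Set V)
        ≤ J.comap ((∏ b ∈ S, t b) • f) := by
      refine Submodule.span_le.2 fun b hb => ?_
      obtain ⟨c, hc⟩ := Finset.dvd_prod_of_mem t hb
      change (∏ b ∈ S, t b) • f b ∈ J
      rw [hc, mul_comm, mul_smul]
      exact J.smul_mem c (htJ b hb)
    exact hle hb

end Localization

/-! ### Valuations of elements and of ideals -/

section Valuation

variable (v : HeightOneSpectrum (𝓞 F))

theorem notMem_mul {s t : 𝓞 F} (hs : s ∉ v.asIdeal) (ht : t ∉ v.asIdeal) :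
    s * t ∉ v.asIdeal := fun h => (v.isPrime.mem_or_mem h).elim hs ht

theorem one_notMem : (1 : 𝓞 F) ∉ v.asIdeal :=
  (Ideal.ne_top_iff_one _).1 v.isPrime.ne_top

theorem valuation_coe_eq_one {s : 𝓞 F} (hs : s ∉ v.asIdeal) : v.valuation F (s : F) = 1 :=
  (v.valuation_eq_one_iff_notMem).2 hs

theorem valuation_smul {s : 𝓞 F} (hs : s ∉ v.asIdeal) (a : F) :
    v.valuation F (s • a) = v.valuation F a := by
  rw [Algebra.smul_def, map_mul]
  erw [valuation_coe_eq_one v hs]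
  rw [one_mul]

theorem valuation_le_one_iff {a : F} :
    v.valuation F a ≤ 1 ↔ ∃ s ∉ v.asIdeal, ∃ c : 𝓞 F, s • a = (c : F) := by
  constructor
  · intro h
    obtain ⟨n, d, h1⟩ := v.exists_primeCompl_mul_eq_of_integer a h
    exact ⟨d, d.2, n, by rw [Algebra.smul_def, mul_comm]; exact h1⟩
  · rintro ⟨s, hs, c, hc⟩
    rw [← valuation_smul v hs, hc]
    exact v.valuation_le_one c

/-- Turns valuation inequalities into divisibility up to a multiplier outside `v`, in place of
working in a localized ring. -/
theorem valuation_le_iff {a d : F} (hd : d ≠ 0) :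
    v.valuation F a ≤ v.valuation F d ↔ ∃ s ∉ v.asIdeal, ∃ c : 𝓞 F, s • a = c • d := by
  have hd' : v.valuation F d ≠ 0 := (Valuation.ne_zero_iff _).2 hd
  have h1 : v.valuation F a ≤ v.valuation F d ↔ v.valuation F (a / d) ≤ 1 := by
    rw [map_div₀, div_le_one₀ (zero_lt_iff.2 hd')]
  rw [h1, valuation_le_one_iff]
  refine exists_congr fun s => and_congr_right fun _ => exists_congr fun c => ?_
  rw [Algebra.smul_def, Algebra.smul_def, Algebra.smul_def, ← mul_div_assoc, div_eq_iff hd]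

/-- The `v`-adic valuation of a nonzero ideal: the valuation of a local generator. -/
noncomputable def idealVal (𝔞 : Ideal (𝓞 F)) : WithZero (Multiplicative ℤ) :=
  open Classical in
  if h : 𝔞 = ⊥ then 0 else
    v.valuation F ((ideal_locally_principal h v.isPrime).choose : F)

theorem exists_local_generator {𝔞 : Ideal (𝓞 F)} (h : 𝔞 ≠ ⊥) :
    ∃ ξ ∈ 𝔞, ξ ≠ 0 ∧ idealVal v 𝔞 = v.valuation F (ξ : F) ∧
      ∀ α ∈ 𝔞, ∃ s ∉ v.asIdeal, ∃ t : 𝓞 F, s * α = t * ξ := by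
  have hs := (ideal_locally_principal h v.isPrime).choose_spec
  exact ⟨_, hs.1, hs.2.1, by rw [idealVal, dif_neg h], hs.2.2⟩

/-- Two local generators divide each other up to multipliers outside `v`, so the choice made in
`idealVal` is harmless. -/
theorem idealVal_eq {𝔞 : Ideal (𝓞 F)} {ξ : 𝓞 F} (h0 : ξ ≠ 0) (hξ : ξ ∈ 𝔞)
    (h : ∀ α ∈ 𝔞, ∃ s ∉ v.asIdeal, ∃ t : 𝓞 F, s * α = t * ξ) :
    idealVal v 𝔞 = v.valuation F (ξ : F) := by
  have hne : 𝔞 ≠ ⊥ := fun h1 => h0 (by simpa [h1] using hξ)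
  obtain ⟨η, hη, hη0, hval, hgen⟩ := exists_local_generator v hne
  have key : ∀ {x y : 𝓞 F}, y ≠ 0 → (∃ s ∉ v.asIdeal, ∃ t : 𝓞 F, s * x = t * y) →
      v.valuation F (x : F) ≤ v.valuation F (y : F) := by
    rintro x y hy ⟨s, hs, t, hst⟩
    refine (valuation_le_iff v (by simpa using hy)).2 ⟨s, hs, t, ?_⟩
    rw [Algebra.smul_def, Algebra.smul_def, ← map_mul, ← map_mul, hst]
  rw [hval]
  exact le_antisymm (key h0 (h η hη)) (key hη0 (hgen ξ hξ))

theorem idealVal_ne_zero {𝔞 : Ideal (𝓞 F)} (h : 𝔞 ≠ ⊥) : idealVal v 𝔞 ≠ 0 := by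
  obtain ⟨ξ, -, h0, hval, -⟩ := exists_local_generator v h
  rw [hval]
  exact (Valuation.ne_zero_iff _).2 (by simpa using h0)

theorem idealVal_mul {𝔞 𝔟 : Ideal (𝓞 F)} (h𝔞 : 𝔞 ≠ ⊥) (h𝔟 : 𝔟 ≠ ⊥) :
    idealVal v (𝔞 * 𝔟) = idealVal v 𝔞 * idealVal v 𝔟 := by
  obtain ⟨ξ, hξ, hξ0, hval, hgen⟩ := exists_local_generator v h𝔞
  obtain ⟨η, hη, hη0, hval', hgen'⟩ := exists_local_generator v h𝔟
  rw [hval, hval', ← map_mul, ← map_mul (algebraMap (𝓞 F) F)]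
  refine idealVal_eq v (mul_ne_zero hξ0 hη0) (Ideal.mul_mem_mul hξ hη) fun α hα => ?_
  refine Submodule.mul_induction_on hα ?_ ?_
  · intro a ha b hb
    obtain ⟨s, hs, t, h1⟩ := hgen a ha
    obtain ⟨s', hs', t', h2⟩ := hgen' b hb
    exact ⟨s * s', notMem_mul v hs hs', t * t', by linear_combination s' * b * h1 + t * ξ * h2⟩
  · rintro a b ⟨s, hs, t, h1⟩ ⟨s', hs', t', h2⟩
    exact ⟨s * s', notMem_mul v hs hs', s' * t + s * t', by
      linear_combination s' * h1 + s * h2⟩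

theorem idealVal_pow_two {𝔞 : Ideal (𝓞 F)} (h : 𝔞 ≠ ⊥) :
    idealVal v (𝔞 ^ 2) = idealVal v 𝔞 ^ 2 := by
  rw [pow_two, pow_two, idealVal_mul v h h]

theorem idealVal_eq_one {𝔞 : Ideal (𝓞 F)} {s : 𝓞 F} (hs : s ∈ 𝔞) (h : s ∉ v.asIdeal) :
    idealVal v 𝔞 = 1 := by
  have h0 : s ≠ 0 := by
    rintro rfl
    exact h (zero_mem _)
  rw [idealVal_eq v h0 hs, valuation_coe_eq_one v h]
  exact fun α _ => ⟨s, h, α, mul_comm _ _⟩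

theorem idealVal_lt_one {𝔞 : Ideal (𝓞 F)} (h : 𝔞 ≤ v.asIdeal) : idealVal v 𝔞 < 1 := by
  by_cases h0 : 𝔞 = ⊥
  · rw [idealVal, dif_pos h0]; exact zero_lt_one
  obtain ⟨ξ, hξ, -, hval, -⟩ := exists_local_generator v h0
  rw [hval]
  exact (v.valuation_lt_one_iff_mem ξ).2 (h hξ)

theorem valuation_le_idealVal_iff {𝔞 : Ideal (𝓞 F)} (h : 𝔞 ≠ ⊥) {a : F} :
    v.valuation F a ≤ idealVal v 𝔞 ↔
      ∃ s ∉ v.asIdeal, s • a ∈ IsLocalization.coeSubmodule F 𝔞 := by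
  obtain ⟨ξ, hξ, hξ0, hval, hgen⟩ := exists_local_generator v h
  rw [hval, valuation_le_iff v (by simpa using hξ0)]
  constructor
  · rintro ⟨s, hs, c, hc⟩
    refine ⟨s, hs, ?_⟩
    rw [hc]
    exact Submodule.smul_mem _ _ ⟨ξ, hξ, rfl⟩
  · rintro ⟨s, hs, α, hα, hsa⟩
    obtain ⟨s', hs', t, ht⟩ := hgen α hα
    refine ⟨s' * s, notMem_mul v hs' hs, t, ?_⟩
    rw [mul_smul, ← hsa, Algebra.linearMap_apply, Algebra.smul_def, Algebra.smul_def, ← map_mul,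
      ← map_mul, ht]

theorem exists_uniformizer : ∃ ϖ ∈ v.asIdeal, ϖ ≠ 0 ∧
    idealVal v v.asIdeal = v.valuation F (ϖ : F) ∧
      ∀ α ∈ v.asIdeal, ∃ s ∉ v.asIdeal, ∃ t : 𝓞 F, s * α = t * ϖ :=
  exists_local_generator v v.ne_bot

theorem valuation_coe_le_idealVal {𝔞 : Ideal (𝓞 F)} {c : 𝓞 F} (hc : c ∈ 𝔞) :
    v.valuation F (c : F) ≤ idealVal v 𝔞 := by
  by_cases h : 𝔞 = ⊥
  · subst h
    rw [(Submodule.mem_bot _).1 hc]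
    simp
  exact (valuation_le_idealVal_iff v h).2 ⟨1, one_notMem v, by rw [one_smul]; exact ⟨c, hc, rfl⟩⟩

theorem exists_notMem_of_ne {v w : HeightOneSpectrum (𝓞 F)} (h : w ≠ v) :
    ∃ s ∈ v.asIdeal, s ∉ w.asIdeal := by
  by_contra! hle
  have hle' : v.asIdeal ≤ w.asIdeal := hle
  have hmax : v.asIdeal.IsMaximal := v.isPrime.isMaximal v.ne_bot
  exact h (HeightOneSpectrum.ext (hmax.eq_of_le w.isPrime.ne_top hle').symm)

end Valuation

variable {B : Type*} [Ring B] [Algebra F B]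

/-! ### Local generators of invertible ideals -/

/-- `x ∈ I ∩ Bˣ` generates the left `R`-module `I` locally at `v`. -/
structure IsLocalGenerator (v : HeightOneSpectrum (𝓞 F)) (R : Subalgebra (𝓞 F) B)
    (I : Submodule (𝓞 F) B) (x : Bˣ) : Prop where
  mem : (x : B) ∈ I
  exists_eq_mul : ∀ b ∈ I, ∃ t ∉ v.asIdeal, ∃ r ∈ R, t • b = r * (x : B)

/-- A nonzero integer of `F` as a unit of `B`. -/
noncomputable def coeUnit (B : Type*) [Ring B] [Algebra F B] {s : 𝓞 F} (hs : s ≠ 0) : Bˣ :=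
  Units.map (algebraMap F B : F →* B) (Units.mk0 (s : F) (by simpa using hs))

theorem mul_coeUnit {s : 𝓞 F} (hs : s ≠ 0) (b : B) : b * (coeUnit B hs : B) = s • b := by
  rw [← algebraMap_smul F s b, Algebra.smul_def, Algebra.commutes]
  rfl

section LocalGenerator

variable (v : HeightOneSpectrum (𝓞 F)) {R : Subalgebra (𝓞 F) B} {I J : Submodule (𝓞 F) B}

theorem ne_zero_of_notMem {s : 𝓞 F} (hs : s ∉ v.asIdeal) : s ≠ 0 := by
  rintro rfl
  exact hs (zero_mem _)

theorem IsLocalGenerator.smul {v} {x : Bˣ} (h : IsLocalGenerator v R I x) {s : 𝓞 F}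
    (hs : s ∉ v.asIdeal) :
    IsLocalGenerator v R I (x * coeUnit B (ne_zero_of_notMem v hs)) where
  mem := by
    rw [Units.val_mul, mul_coeUnit]
    exact I.smul_mem s h.mem
  exists_eq_mul b hb := by
    obtain ⟨t, ht, r, hr, hrb⟩ := h.exists_eq_mul b hb
    refine ⟨s * t, notMem_mul v hs ht, r, hr, ?_⟩
    rw [Units.val_mul, mul_coeUnit, mul_smul_comm, ← hrb, mul_smul]

theorem IsLocalGenerator.of_le {v} {x : Bˣ} (h : IsLocalGenerator v R J x) (hJ : J ≤ I)
    (hI : ∀ b ∈ I, ∃ t ∉ v.asIdeal, t • b ∈ J) : IsLocalGenerator v R I x where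
  mem := hJ h.mem
  exists_eq_mul b hb := by
    obtain ⟨t, ht, htb⟩ := hI b hb
    obtain ⟨s, hs, r, hr, hrb⟩ := h.exists_eq_mul _ htb
    exact ⟨s * t, notMem_mul v hs ht, r, hr, by rw [mul_smul, hrb]⟩

/-- A multiplier outside `v` moves the generator of `I` into `J` without spoiling generation at `v`.
-/
theorem IsLocalGenerator.exists_of_locally_le {v} {x : Bˣ} (h : IsLocalGenerator v R I x)
    (hJ : J ≤ I) (hI : ∀ b ∈ I, ∃ t ∉ v.asIdeal, t • b ∈ J) :
    ∃ y : Bˣ, IsLocalGenerator v R J y := by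
  obtain ⟨s, hs, hsx⟩ := hI x h.mem
  have h1 := h.smul hs
  refine ⟨_, ?_, fun b hb => h1.exists_eq_mul b (hJ hb)⟩
  rwa [Units.val_mul, mul_coeUnit]

/-- The unit from local principality lies only in the localization of `I`; a multiplier outside `v`
brings it into `I`. -/
theorem IsInvertibleLeftIdeal.exists_isLocalGenerator (h : IsInvertibleLeftIdeal R I) :
    ∃ x : Bˣ, IsLocalGenerator v R I x := by
  obtain ⟨x, hx⟩ := h.locallyPrincipal v.asIdeal v.isPrime v.ne_bot
  have h1 : (x : B) ∈ locAt v.asIdeal I := by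
    rw [hx]
    exact ⟨1, ⟨1, one_notMem v, by rw [one_smul]; exact R.one_mem⟩, one_mul _⟩
  obtain ⟨s, hs, hsx⟩ := h1
  refine ⟨x * coeUnit B (ne_zero_of_notMem v hs), ?_, fun b hb => ?_⟩
  · rwa [Units.val_mul, mul_coeUnit]
  · have h2 : b ∈ locAt v.asIdeal I := ⟨1, one_notMem v, by rwa [one_smul]⟩
    rw [hx] at h2
    obtain ⟨c, ⟨t, ht, htc⟩, rfl⟩ := h2
    refine ⟨s * t, notMem_mul v hs ht, t • c, htc, ?_⟩
    rw [Units.val_mul, mul_coeUnit, mul_smul_comm, mul_smul, smul_mul_assoc]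

theorem IsInvertibleLeftIdeal.of_isLocalGenerator (hI : Submodule.IsLattice F I)
    (hmul : ∀ r ∈ R, ∀ b ∈ I, r * b ∈ I)
    (hgen : ∀ v : HeightOneSpectrum (𝓞 F), ∃ x : Bˣ, IsLocalGenerator v R I x) :
    IsInvertibleLeftIdeal R I where
  isLattice := hI
  mul_mem := hmul
  locallyPrincipal 𝔭 h𝔭 h0 := by
    obtain ⟨x, hx⟩ := hgen ⟨𝔭, h𝔭, h0⟩
    refine ⟨x, Set.Subset.antisymm ?_ ?_⟩
    · rintro b ⟨s, hs, hsb⟩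
      obtain ⟨t, ht, r, hr, hrb⟩ := hx.exists_eq_mul _ hsb
      refine ⟨b * ((x⁻¹ : Bˣ) : B), ⟨t * s, fun h => (h𝔭.mem_or_mem h).elim ht hs, ?_⟩, by simp⟩
      rw [mul_smul, ← smul_mul_assoc, ← smul_mul_assoc, hrb]
      simpa using hr
    · rintro _ ⟨c, ⟨s, hs, hsc⟩, rfl⟩
      refine ⟨s, hs, ?_⟩
      change s • (c * (x : B)) ∈ I
      rw [← smul_mul_assoc]
      exact hmul _ hsc _ hx.mem

end LocalGenerator

/-! ### The local index -/

section Index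

variable [Module.Finite F B] (v : HeightOneSpectrum (𝓞 F)) {R : Subalgebra (𝓞 F) B}
  {I J : Submodule (𝓞 F) B}

theorem det_mem_of_mapsTo (hI : Submodule.IsLattice F I) (δ : B →ₗ[F] B)
    (hδ : ∀ x ∈ I, δ x ∈ I) : ∃ c : 𝓞 F, (c : F) = LinearMap.det δ := by
  obtain ⟨a, ha⟩ := exists_algebraMap_eq_charpoly_coeff hI δ hδ 0
  refine ⟨(-1) ^ Module.finrank F B * a, ?_⟩
  rw [LinearMap.det_eq_sign_charpoly_coeff, ← ha]
  simp

/-- Right multiplication by a unit has nonzero determinant. -/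
theorem det_mulRight_ne_zero (x : Bˣ) : LinearMap.det (LinearMap.mulRight F (x : B)) ≠ 0 := by
  intro h
  have h1 : LinearMap.mulRight F (x : B) ∘ₗ LinearMap.mulRight F ((x⁻¹ : Bˣ) : B)
      = LinearMap.id := by ext; simp
  have h2 := congrArg LinearMap.det h1
  rw [LinearMap.det_comp, h, zero_mul, LinearMap.det_id] at h2
  exact zero_ne_one h2

theorem det_mulRight_mul (x y : B) : LinearMap.det (LinearMap.mulRight F (x * y))
    = LinearMap.det (LinearMap.mulRight F x) * LinearMap.det (LinearMap.mulRight F y) := by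
  have h : LinearMap.mulRight F (x * y) = LinearMap.mulRight F y ∘ₗ LinearMap.mulRight F x := by
    ext; simp [mul_assoc]
  rw [h, LinearMap.det_comp, mul_comm]

theorem valuation_det_smul {t : 𝓞 F} (ht : t ∉ v.asIdeal) (δ : B →ₗ[F] B) :
    v.valuation F (LinearMap.det ((t : F) • δ)) = v.valuation F (LinearMap.det δ) := by
  rw [LinearMap.det_smul, map_mul, map_pow, valuation_coe_eq_one v ht, one_pow, one_mul]

/-- The index is locally generated by the determinant of the right multiplication that carries
a local generator to a local generator. -/
theorem exists_smul_mem_index_iff (hI : Submodule.IsLattice F I)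
    (hImul : ∀ r ∈ R, ∀ b ∈ I, r * b ∈ I) (hJmul : ∀ r ∈ R, ∀ b ∈ J, r * b ∈ J) {x y : Bˣ}
    (hx : IsLocalGenerator v R I x) (hy : IsLocalGenerator v R J y) (a : F) :
    (∃ s ∉ v.asIdeal, s • a ∈ index I J) ↔
      v.valuation F a ≤
        v.valuation F (LinearMap.det (LinearMap.mulRight F ((x⁻¹ * y : Bˣ) : B))) := by
  constructor
  · rintro ⟨s, hs, hsa⟩
    rw [← valuation_smul v hs]
    refine Submodule.span_induction (p := fun d _ => v.valuation F d ≤ _) ?_ ?_ ?_ ?_ hsa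
    · rintro _ ⟨δ, hδ, rfl⟩
      -- Multiplying back from `J` to `I` gives, up to `t`, an endomorphism of the lattice `I`, so
      -- its determinant is `v`-integral.
      let δ' : B →ₗ[F] B := LinearMap.mulRight F ((y⁻¹ * x : Bˣ) : B) ∘ₗ δ
      obtain ⟨t, ht, htI⟩ := exists_common_multiplier v hI.fg I (δ'.restrictScalars (𝓞 F)) (by
        intro b hb
        obtain ⟨t, ht, r, hr, hrb⟩ := hy.exists_eq_mul _ (hδ b hb)
        refine ⟨t, ht, ?_⟩
        have h1 : t • (LinearMap.restrictScalars (𝓞 F) δ') b = r * x := by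
          change t • (δ b * ((y⁻¹ * x : Bˣ) : B)) = _
          rw [← smul_mul_assoc, hrb, mul_assoc, ← Units.val_mul, mul_inv_cancel_left]
        rw [h1]
        exact hImul r hr _ hx.mem)
      obtain ⟨c, hc⟩ := det_mem_of_mapsTo hI ((t : F) • δ') (by
        intro b hb
        have h1 := htI b hb
        rwa [← algebraMap_smul F t] at h1)
      have h2 : v.valuation F (LinearMap.det δ') ≤ 1 := by
        rw [← valuation_det_smul v ht, ← hc]
        exact v.valuation_le_one c
      have h3 : δ = LinearMap.mulRight F ((x⁻¹ * y : Bˣ) : B) ∘ₗ δ' := by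
        ext b
        simp [δ', mul_assoc]
      rw [h3, LinearMap.det_comp, map_mul]
      exact mul_le_of_le_one_right' h2
    · rw [map_zero]; exact zero_le
    · intro c d _ _ hc hd
      exact (Valuation.map_add _ _ _).trans (max_le hc hd)
    · intro c d _ hd
      rw [Algebra.smul_def, map_mul]
      exact (mul_le_of_le_one_left' (v.valuation_le_one c)).trans hd
  · intro h
    obtain ⟨s, hs, c, hc⟩ := (valuation_le_iff v (det_mulRight_ne_zero (F := F) (x⁻¹ * y))).1 h
    set m := LinearMap.mulRight F ((x⁻¹ * y : Bˣ) : B) with hm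
    obtain ⟨t, ht, htI⟩ := exists_common_multiplier v hI.fg J (m.restrictScalars (𝓞 F)) (by
      intro b hb
      obtain ⟨t, ht, r, hr, hrb⟩ := hx.exists_eq_mul b hb
      refine ⟨t, ht, ?_⟩
      have h1 : t • (LinearMap.restrictScalars (𝓞 F) m) b = r * y := by
        change t • (b * ((x⁻¹ * y : Bˣ) : B)) = _
        rw [← smul_mul_assoc, hrb, mul_assoc, ← Units.val_mul, mul_inv_cancel_left]
      rw [h1]
      exact hJmul r hr _ hy.mem)
    have h1 : LinearMap.det ((t : F) • m) ∈ index I J := by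
      refine Submodule.subset_span ⟨_, fun b hb => ?_, rfl⟩
      have h2 := htI b hb
      rwa [← algebraMap_smul F t] at h2
    -- Scaling `m` by `t` scales its determinant by this power, which is still prime to `v`.
    have htn : t ^ Module.finrank F B ∉ v.asIdeal := fun h => ht (v.isPrime.mem_of_pow_mem _ h)
    refine ⟨t ^ Module.finrank F B * s, notMem_mul v htn hs, ?_⟩
    have h3 : (t ^ Module.finrank F B * s) • a = c • LinearMap.det ((t : F) • m) := by
      rw [mul_smul, hc, LinearMap.det_smul, smul_comm, Algebra.smul_def (t ^ Module.finrank F B),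
        map_pow]
    rw [h3]
    exact Submodule.smul_mem _ c h1

end Index

namespace LeftIdeals

variable [Module.Finite F B] (v : HeightOneSpectrum (𝓞 F)) {R : Subalgebra (𝓞 F) B}

/-- A local generator of `I` at `v`. -/
noncomputable def gen (I : LeftIdeals R) : Bˣ := (I.2.exists_isLocalGenerator v).choose

theorem isLocalGenerator_gen (I : LeftIdeals R) : IsLocalGenerator v R I.1 (I.gen v) :=
  (I.2.exists_isLocalGenerator v).choose_spec

/-- The valuation at `v` of the index `[I : J]`. -/
noncomputable def localIndex (I J : LeftIdeals R) : WithZero (Multiplicative ℤ) :=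
  v.valuation F (LinearMap.det (LinearMap.mulRight F (((I.gen v)⁻¹ * J.gen v : Bˣ) : B)))

theorem exists_smul_mem_index_iff (I J : LeftIdeals R) (a : F) :
    (∃ s ∉ v.asIdeal, s • a ∈ index I.1 J.1) ↔ v.valuation F a ≤ localIndex v I J :=
  QuatModForm.exists_smul_mem_index_iff v I.2.isLattice I.2.mul_mem J.2.mul_mem
    (I.isLocalGenerator_gen v) (J.isLocalGenerator_gen v) a

/-- Either choice of generators describes the same module `index I.1 J.1` at `v`, so `gen` may be
replaced by convenient generators. -/
theorem localIndex_eq {I J : LeftIdeals R} {x y : Bˣ} (hx : IsLocalGenerator v R I.1 x)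
    (hy : IsLocalGenerator v R J.1 y) : localIndex v I J
      = v.valuation F (LinearMap.det (LinearMap.mulRight F ((x⁻¹ * y : Bˣ) : B))) := by
  have h := fun a => (exists_smul_mem_index_iff v I J a).symm.trans
    (QuatModForm.exists_smul_mem_index_iff v I.2.isLattice I.2.mul_mem J.2.mul_mem hx hy a)
  exact le_antisymm ((h _).1 le_rfl) ((h _).2 le_rfl)

/-- With one fixed generator per ideal, the determinants telescope. -/
theorem localIndex_mul (I J K : LeftIdeals R) :
    localIndex v I J * localIndex v J K = localIndex v I K := by
  rw [localIndex, localIndex, localIndex, ← map_mul, ← det_mulRight_mul, ← Units.val_mul,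
    mul_assoc, mul_inv_cancel_left]

theorem index_eq_iff {I J : LeftIdeals R} {𝔞 : Ideal (𝓞 F)} (h𝔞 : 𝔞 ≠ ⊥) :
    index I.1 J.1 = IsLocalization.coeSubmodule F 𝔞 ↔
      ∀ v, localIndex v I J = idealVal v 𝔞 := by
  constructor
  · intro h v
    have h1 : ∀ a : F, v.valuation F a ≤ localIndex v I J ↔ v.valuation F a ≤ idealVal v 𝔞 := by
      intro a
      rw [← exists_smul_mem_index_iff, valuation_le_idealVal_iff v h𝔞, h]
    obtain ⟨ξ, -, -, hval, -⟩ := exists_local_generator v h𝔞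
    rw [hval] at h1 ⊢
    exact le_antisymm ((h1 _).1 le_rfl) ((h1 _).2 le_rfl)
  · intro h
    have h1 : ∀ (v : HeightOneSpectrum (𝓞 F)) (a : F), (∃ s ∉ v.asIdeal, s • a ∈ index I.1 J.1) ↔
        ∃ s ∉ v.asIdeal, s • a ∈ IsLocalization.coeSubmodule F 𝔞 := by
      intro v a
      rw [exists_smul_mem_index_iff, ← valuation_le_idealVal_iff v h𝔞, h]
    refine le_antisymm (fun a ha => ?_) (fun a ha => ?_)
    · exact mem_of_forall_locally_mem fun v =>
        (h1 v a).1 ⟨1, one_notMem v, by rwa [one_smul]⟩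
    · exact mem_of_forall_locally_mem fun v =>
        (h1 v a).2 ⟨1, one_notMem v, by rwa [one_smul]⟩

/-- The index annihilates `I / J`, by Cayley–Hamilton through `det_smul_mem`. -/
theorem smul_mem_of_mem_index {I J : LeftIdeals R} (hJ : J.1 ≤ I.1) {c : 𝓞 F}
    (hc : (c : F) ∈ index I.1 J.1) {b : B} (hb : b ∈ I.1) : c • b ∈ J.1 := by
  have h1 : ∀ d ∈ index I.1 J.1, d • b ∈ J.1 := by
    intro d hd
    refine Submodule.span_induction ?_ ?_ ?_ ?_ hd
    · rintro _ ⟨δ, hδ, rfl⟩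
      exact det_smul_mem I.2.isLattice hJ δ hδ b hb
    · simp
    · intro d e _ _ hd he
      rw [add_smul]
      exact add_mem hd he
    · intro a d _ hd
      rw [smul_assoc]
      exact J.1.smul_mem a hd
  have h2 := h1 _ hc
  rwa [← algebraMap_smul F c]

theorem exists_smul_mem_of_localIndex_eq_one {I J : LeftIdeals R} (hJ : J.1 ≤ I.1)
    (h : localIndex v I J = 1) {b : B} (hb : b ∈ I.1) : ∃ s ∉ v.asIdeal, s • b ∈ J.1 := by
  obtain ⟨s, hs, h1⟩ := (exists_smul_mem_index_iff v I J 1).2 (by rw [h, map_one])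
  refine ⟨s, hs, smul_mem_of_mem_index hJ ?_ hb⟩
  rwa [Algebra.smul_def, mul_one] at h1

theorem localIndex_eq_one {I J : LeftIdeals R} (hJ : J.1 ≤ I.1)
    (h : ∀ b ∈ I.1, ∃ s ∉ v.asIdeal, s • b ∈ J.1) : localIndex v I J = 1 := by
  have hy := J.isLocalGenerator_gen v
  rw [localIndex_eq v (hy.of_le hJ h) hy, inv_mul_cancel, Units.val_one, LinearMap.mulRight_one,
    LinearMap.det_id, map_one]

theorem localIndex_self (I : LeftIdeals R) : localIndex v I I = 1 :=
  localIndex_eq_one v le_rfl fun b hb => ⟨1, one_notMem v, by rwa [one_smul]⟩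

theorem eq_of_localIndex_eq_one {I J : LeftIdeals R} (hJ : J.1 ≤ I.1)
    (h : ∀ v, localIndex v I J = 1) : J = I :=
  Subtype.ext (le_antisymm hJ fun _ hb => mem_of_forall_locally_mem fun v =>
    exists_smul_mem_of_localIndex_eq_one v hJ (h v) hb)

theorem mem_heckeSet_iff {I J : LeftIdeals R} {𝔪 : Ideal (𝓞 F)} (h𝔪 : 𝔪 ≠ ⊥) :
    J ∈ heckeSet 𝔪 I ↔ J.1 ≤ I.1 ∧ ∀ v, localIndex v I J = idealVal v 𝔪 ^ 2 := by
  change J.1 ≤ I.1 ∧ index I.1 J.1 = IsLocalization.coeSubmodule F (𝔪 ^ 2) ↔ _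
  rw [index_eq_iff (pow_ne_zero 2 h𝔪)]
  simp_rw [idealVal_pow_two _ h𝔪]

/-- Local indices multiply along `I ⊇ J ⊇ K`, and the factor `idealVal v 𝔫 ^ 2` cancels. -/
theorem mem_heckeSet_mul_iff {I J K : LeftIdeals R} {𝔪 𝔫 : Ideal (𝓞 F)} (h𝔪 : 𝔪 ≠ ⊥)
    (h𝔫 : 𝔫 ≠ ⊥) (hJ : J ∈ heckeSet 𝔫 I) :
    K ∈ heckeSet 𝔪 J ↔ K ∈ heckeSet (𝔪 * 𝔫) I ∧ K.1 ≤ J.1 := by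
  rw [mem_heckeSet_iff h𝔫] at hJ
  rw [mem_heckeSet_iff h𝔪, mem_heckeSet_iff (mul_ne_zero h𝔪 h𝔫)]
  have h : ∀ v, localIndex v J K = idealVal v 𝔪 ^ 2 ↔
      localIndex v I K = idealVal v (𝔪 * 𝔫) ^ 2 := by
    intro v
    rw [← localIndex_mul v I J K, idealVal_mul v h𝔪 h𝔫, hJ.2 v, mul_pow, mul_comm]
    exact (mul_left_inj' (pow_ne_zero 2 (idealVal_ne_zero v h𝔫))).symm
  simp_rw [h]
  exact ⟨fun h => ⟨⟨h.1.trans hJ.1, h.2⟩, h.1⟩, fun h => ⟨h.2, h.1.2⟩⟩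

/-- Invertibility test for intermediate modules: at each prime, either exhibit a generator or show
agreement with `I`. The lattice `K` only ensures full rank. -/
theorem isInvertibleLeftIdeal_of_le {I : LeftIdeals R} {J : Submodule (𝓞 F) B} (hJ : J ≤ I.1)
    (hmul : ∀ r ∈ R, ∀ b ∈ J, r * b ∈ J) {K : Submodule (𝓞 F) B} (hK : Submodule.IsLattice F K)
    (hKJ : K ≤ J)
    (hgen : ∀ v : HeightOneSpectrum (𝓞 F), (∃ x : Bˣ, IsLocalGenerator v R J x) ∨
      ∀ b ∈ I.1, ∃ s ∉ v.asIdeal, s • b ∈ J) : IsInvertibleLeftIdeal R J := by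
  have hfin : Module.Finite (𝓞 F) I.1 := Module.Finite.iff_fg.2 I.2.isLattice.fg
  have hfg : J.FG := by
    have h1 := (isNoetherian_submodule.1 (inferInstance : IsNoetherian (𝓞 F) I.1)) J hJ
    exact h1
  refine .of_isLocalGenerator (Submodule.IsLattice.of_le_of_isLattice_of_fg F hKJ hfg) hmul
    fun v => (hgen v).elim id fun h => ?_
  exact (I.isLocalGenerator_gen v).exists_of_locally_le hJ h

end LeftIdeals

/-! ### Products of Hecke operators -/

section Hecke

variable [Module.Finite F B] {R : Subalgebra (𝓞 F) B}

open LeftIdeals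

theorem module_end_ext {f g : Module.End ℂ (M R)}
    (h : ∀ I : LeftIdeals R, f (Finsupp.single I.cl 1) = g (Finsupp.single I.cl 1)) : f = g := by
  refine Finsupp.lhom_ext' fun c => LinearMap.ext_ring ?_
  obtain ⟨I, rfl⟩ := Quotient.exists_rep c
  exact h I

/-- The number of `J ∈ t_𝔫(I)` that contain `K`. -/
noncomputable def numBetween (𝔫 : Ideal (𝓞 F)) (I K : LeftIdeals R) : ℕ :=
  {J ∈ heckeSet 𝔫 I | K.1 ≤ J.1}.ncard

/-- Exchanging the sums over `J` and `K` reduces products of Hecke operators to counting. -/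
theorem hecke_mul_hecke_cl {𝔪 𝔫 : Ideal (𝓞 F)} (h𝔪 : 𝔪 ≠ ⊥) (h𝔫 : 𝔫 ≠ ⊥) (I : LeftIdeals R) :
    (hecke R 𝔪 * hecke R 𝔫) (Finsupp.single I.cl 1)
      = ∑ K ∈ (heckeSet_finite (mul_ne_zero h𝔪 h𝔫) I).toFinset,
          (numBetween 𝔫 I K : ℂ) • Finsupp.single K.cl (1 : ℂ) := by
  classical
  rw [Module.End.mul_apply, hecke_cl R h𝔫, map_sum]
  have h1 : ∀ J ∈ (heckeSet_finite h𝔫 I).toFinset, hecke R 𝔪 (Finsupp.single J.cl 1)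
      = ∑ K ∈ (heckeSet_finite (mul_ne_zero h𝔪 h𝔫) I).toFinset,
          if K.1 ≤ J.1 then Finsupp.single K.cl (1 : ℂ) else 0 := by
    intro J hJ
    rw [Set.Finite.mem_toFinset] at hJ
    rw [hecke_cl R h𝔪, ← Finset.sum_filter]
    refine Finset.sum_congr (Finset.ext fun K => ?_) fun _ _ => rfl
    simp only [Set.Finite.mem_toFinset, Finset.mem_filter]
    exact mem_heckeSet_mul_iff h𝔪 h𝔫 hJ
  rw [Finset.sum_congr rfl h1, Finset.sum_comm]
  refine Finset.sum_congr rfl fun K _ => ?_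
  rw [← Finset.sum_filter, Finset.sum_const, numBetween]
  have h2 : {J ∈ heckeSet 𝔫 I | K.1 ≤ J.1}
      = ↑({J ∈ (heckeSet_finite h𝔫 I).toFinset | K.1 ≤ J.1} : Finset (LeftIdeals R)) := by
    ext J; simp
  rw [h2, Set.ncard_coe_finset, Nat.cast_smul_eq_nsmul]

/-- Both have the same index in `I`, so the index of `J` in `L` is trivial at every prime. -/
theorem heckeSet_eq_of_le {𝔫 : Ideal (𝓞 F)} (h𝔫 : 𝔫 ≠ ⊥) {I J L : LeftIdeals R}
    (hJ : J ∈ heckeSet 𝔫 I) (hL : L ∈ heckeSet 𝔫 I) (h : J.1 ≤ L.1) : J = L := by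
  refine eq_of_localIndex_eq_one h fun v => ?_
  rw [mem_heckeSet_iff h𝔫] at hL hJ
  have h1 := localIndex_mul v I L J
  rw [hL.2, hJ.2] at h1
  exact mul_left_cancel₀ (pow_ne_zero 2 (idealVal_ne_zero v h𝔫)) (h1.trans (mul_one _).symm)

/-- `K + 𝔫² I` is the unique ideal in `t_𝔫(I)` containing `K ∈ t_𝔪𝔫(I)`, for coprime `𝔪, 𝔫`. -/
theorem numBetween_of_isCoprime {𝔪 𝔫 : Ideal (𝓞 F)} (h𝔪 : 𝔪 ≠ ⊥) (h𝔫 : 𝔫 ≠ ⊥)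
    (h : IsCoprime 𝔪 𝔫) {I K : LeftIdeals R} (hK : K ∈ heckeSet (𝔪 * 𝔫) I) :
    numBetween 𝔫 I K = 1 := by
  -- At each prime one of the two ideals is trivial: where `𝔪` is, `J` below agrees with `K`; where
  -- `𝔫` is, it agrees with `I`.
  have hcop : ∀ v : HeightOneSpectrum (𝓞 F),
      (∃ s ∈ 𝔪 ^ 2, s ∉ v.asIdeal) ∨ ∃ s ∈ 𝔫 ^ 2, s ∉ v.asIdeal := by
    intro v
    by_contra! hv
    have h1 : IsCoprime (𝔪 ^ 2) (𝔫 ^ 2) := h.pow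
    rw [Ideal.isCoprime_iff_sup_eq] at h1
    exact v.isPrime.ne_top (top_le_iff.1 (h1 ▸ sup_le hv.1 hv.2))
  have hKI := hK.1
  have hsmul : ∀ c ∈ (𝔪 * 𝔫) ^ 2, ∀ b ∈ I.1, c • b ∈ K.1 := fun c hc b hb =>
    smul_mem_of_mem_index hKI (hK.2 ▸ ⟨c, hc, rfl⟩) hb
  rw [mem_heckeSet_iff (mul_ne_zero h𝔪 h𝔫)] at hK
  let J : Submodule (𝓞 F) B := K.1 ⊔ 𝔫 ^ 2 • I.1
  have hJI : J ≤ I.1 := sup_le hKI Submodule.smul_le_right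
  have hKJ : K.1 ≤ J := le_sup_left
  have hJ1 : ∀ s ∈ 𝔫 ^ 2, ∀ b ∈ I.1, s • b ∈ J := fun s hs b hb =>
    Submodule.mem_sup_right (Submodule.smul_mem_smul hs hb)
  have hJ2 : ∀ s ∈ 𝔪 ^ 2, ∀ b ∈ J, s • b ∈ K.1 := by
    intro s hs b hb
    obtain ⟨k, hk, c, hc, rfl⟩ := Submodule.mem_sup.1 hb
    rw [smul_add]
    refine add_mem (K.1.smul_mem s hk) ?_
    refine Submodule.smul_induction_on hc (fun n hn b hb => ?_) (fun x y hx hy => ?_)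
    · rw [← mul_smul]
      refine hsmul _ ?_ b hb
      rw [mul_pow]
      exact Ideal.mul_mem_mul hs hn
    · rw [smul_add]
      exact add_mem hx hy
  have hJmul : ∀ r ∈ R, ∀ b ∈ J, r * b ∈ J := by
    intro r hr b hb
    obtain ⟨k, hk, c, hc, rfl⟩ := Submodule.mem_sup.1 hb
    rw [mul_add]
    exact add_mem (hKJ (K.2.mul_mem r hr k hk))
      (Submodule.mem_sup_right ((I.2.smul (pow_ne_zero 2 h𝔫)).mul_mem r hr c hc))
  have hJinv : IsInvertibleLeftIdeal R J := by
    refine isInvertibleLeftIdeal_of_le hJI hJmul K.2.isLattice hKJ fun v => ?_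
    rcases hcop v with ⟨s, hs, hsv⟩ | ⟨s, hs, hsv⟩
    · exact Or.inl ⟨_, (K.isLocalGenerator_gen v).of_le hKJ fun b hb => ⟨s, hsv, hJ2 s hs b hb⟩⟩
    · exact Or.inr fun b hb => ⟨s, hsv, hJ1 s hs b hb⟩
  let J' : LeftIdeals R := ⟨J, hJinv⟩
  have hJ' : J' ∈ heckeSet 𝔫 I := by
    rw [mem_heckeSet_iff h𝔫]
    refine ⟨hJI, fun v => ?_⟩
    rcases hcop v with ⟨s, hs, hsv⟩ | ⟨s, hs, hsv⟩
    · have h1 : localIndex v J' K = 1 :=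
        localIndex_eq_one v hKJ fun b hb => ⟨s, hsv, hJ2 s hs b hb⟩
      have h2 := localIndex_mul v I J' K
      rw [h1, mul_one] at h2
      rw [h2, hK.2, idealVal_mul v h𝔪 h𝔫, idealVal_eq_one v (Ideal.pow_le_self two_ne_zero hs) hsv,
        one_mul]
    · rw [idealVal_eq_one v (Ideal.pow_le_self two_ne_zero hs) hsv, one_pow]
      exact localIndex_eq_one v hJI fun b hb => ⟨s, hsv, hJ1 s hs b hb⟩
  rw [numBetween, Set.ncard_eq_one]
  refine ⟨J', Set.eq_singleton_iff_unique_mem.2 ⟨⟨hJ', hKJ⟩, ?_⟩⟩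
  rintro L ⟨hL, hKL⟩
  -- Any competitor contains `𝔫²I` because its index annihilates `I / L`; equality of indices then
  -- finishes.
  have hJL : J'.1 ≤ L.1 := by
    refine sup_le hKL (Submodule.smul_le.2 fun c hc b hb => ?_)
    exact smul_mem_of_mem_index hL.1 (hL.2 ▸ ⟨c, hc, rfl⟩) hb
  exact (heckeSet_eq_of_le h𝔫 hJ' hL hJL).symm

theorem hecke_mul_of_isCoprime {𝔪 𝔫 : Ideal (𝓞 F)} (h𝔪 : 𝔪 ≠ ⊥) (h𝔫 : 𝔫 ≠ ⊥)
    (h : IsCoprime 𝔪 𝔫) : hecke R 𝔪 * hecke R 𝔫 = hecke R (𝔪 * 𝔫) := by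
  refine module_end_ext fun I => ?_
  rw [hecke_mul_hecke_cl h𝔪 h𝔫, hecke_cl R (mul_ne_zero h𝔪 h𝔫)]
  refine Finset.sum_congr rfl fun K hK => ?_
  rw [numBetween_of_isCoprime h𝔪 h𝔫 h ((Set.Finite.mem_toFinset _).1 hK), Nat.cast_one, one_smul]

/-! ### Multiplication by ideals of `F` -/

theorem isLocalGenerator_smul (v : HeightOneSpectrum (𝓞 F)) {I : Submodule (𝓞 F) B} {x : Bˣ}
    (hx : IsLocalGenerator v R I x) {𝔞 : Ideal (𝓞 F)} {ξ : 𝓞 F} (hξ : ξ ∈ 𝔞) (h0 : ξ ≠ 0)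
    (hgen : ∀ α ∈ 𝔞, ∃ s ∉ v.asIdeal, ∃ t : 𝓞 F, s * α = t * ξ) :
    IsLocalGenerator v R (𝔞 • I) (x * coeUnit B h0) where
  mem := by
    rw [Units.val_mul, mul_coeUnit]
    exact Submodule.smul_mem_smul hξ hx.mem
  exists_eq_mul b hb := by
    refine Submodule.smul_induction_on hb (fun α hα c hc => ?_) ?_
    · obtain ⟨s, hs, t, hst⟩ := hgen α hα
      obtain ⟨u, hu, r, hr, hur⟩ := hx.exists_eq_mul c hc
      refine ⟨u * s, notMem_mul v hu hs, t • r, R.smul_mem hr t, ?_⟩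
      rw [Units.val_mul, mul_coeUnit, mul_smul_comm, smul_mul_assoc, ← hur, ← mul_smul, ← mul_smul,
        ← mul_smul]
      congr 1
      linear_combination u * hst
    · rintro b c ⟨s, hs, r, hr, h1⟩ ⟨t, ht, q, hq, h2⟩
      refine ⟨s * t, notMem_mul v hs ht, t • r + s • q,
        add_mem (R.smul_mem hr t) (R.smul_mem hq s), ?_⟩
      rw [smul_add, add_mul, smul_mul_assoc, smul_mul_assoc, ← h1, ← h2, ← mul_smul, ← mul_smul,
        mul_comm t s]

theorem det_mulRight_coeUnit {s : 𝓞 F} (hs : s ≠ 0) :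
    LinearMap.det (LinearMap.mulRight F (coeUnit B hs : B)) = (s : F) ^ Module.finrank F B := by
  have h : LinearMap.mulRight F (coeUnit B hs : B) = (s : F) • LinearMap.id := by
    ext b
    rw [LinearMap.mulRight_apply, mul_coeUnit, ← algebraMap_smul F s b]
    rfl
  rw [h, LinearMap.det_smul, LinearMap.det_id, mul_one]

theorem localIndex_idealMul (v : HeightOneSpectrum (𝓞 F)) (I : LeftIdeals R) {𝔞 : Ideal (𝓞 F)}
    (h𝔞 : 𝔞 ≠ ⊥) :
    localIndex v I (I.idealMul 𝔞 h𝔞) = idealVal v 𝔞 ^ Module.finrank F B := by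
  obtain ⟨ξ, hξ, h0, hval, hgen⟩ := exists_local_generator v h𝔞
  have hx := I.isLocalGenerator_gen v
  rw [localIndex_eq v hx (isLocalGenerator_smul v hx hξ h0 hgen), inv_mul_cancel_left,
    det_mulRight_coeUnit, map_pow, hval]

/-- Choose `𝔟` with `𝔞𝔟` principal; a principal ideal acts as multiplication by a central unit of
`B`, which is invertible. -/
theorem idealMul_bijective {𝔞 : Ideal (𝓞 F)} (h𝔞 : 𝔞 ≠ ⊥) :
    Function.Bijective (fun I : LeftIdeals R => I.idealMul 𝔞 h𝔞) := by
  obtain ⟨α, hα, hα0⟩ := Submodule.exists_mem_ne_zero_of_ne_bot h𝔞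
  obtain ⟨𝔟, h𝔟⟩ := Ideal.dvd_iff_le.2 ((Ideal.span_singleton_le_iff_mem (I := 𝔞)).2 hα)
  have h𝔟0 : 𝔟 ≠ ⊥ := by
    rintro rfl
    rw [Ideal.mul_bot, Ideal.span_singleton_eq_bot] at h𝔟
    exact hα0 h𝔟
  have key : ∀ I : LeftIdeals R, (I.mulUnit (coeUnit B hα0)).1 = 𝔞 • 𝔟 • I.1 := by
    intro I
    rw [← Submodule.mul_smul, ← h𝔟]
    ext b
    rw [Submodule.ideal_span_singleton_smul, Submodule.mem_smul_pointwise_iff_exists]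
    change b ∈ Submodule.map _ _ ↔ _
    rw [Submodule.mem_map]
    exact exists_congr fun c => and_congr_right fun _ => by
      rw [LinearMap.mulRight_apply, mul_coeUnit]
  have hcancel : ∀ N : Submodule (𝓞 F) B,
      QuatModForm.mulUnit (QuatModForm.mulUnit N (coeUnit B hα0)) (coeUnit B hα0)⁻¹ = N := by
    intro N
    rw [QuatModForm.mulUnit_mul, mul_inv_cancel, mulUnit_one]
  constructor
  · intro I J h
    have h0 : 𝔞 • I.1 = 𝔞 • J.1 := congrArg Subtype.val h
    have h1 : (I.mulUnit (coeUnit B hα0)).1 = (J.mulUnit (coeUnit B hα0)).1 := by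
      rw [key, key, ← Submodule.mul_smul, ← Submodule.mul_smul, mul_comm, Submodule.mul_smul,
        Submodule.mul_smul, h0]
    have h2 := congrArg (fun N => QuatModForm.mulUnit N (coeUnit B hα0)⁻¹) h1
    exact Subtype.ext (((hcancel I.1).symm.trans h2).trans (hcancel J.1))
  · intro I
    refine ⟨(I.idealMul 𝔟 h𝔟0).mulUnit (coeUnit B hα0)⁻¹, Subtype.ext ?_⟩
    have h1 := congrArg Subtype.val
      (LeftIdeals.idealMul_mulUnit 𝔞 h𝔞 (I.idealMul 𝔟 h𝔟0) (coeUnit B hα0)⁻¹)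
    refine h1.trans ?_
    have h2 : QuatModForm.mulUnit I.1 (coeUnit B hα0) = 𝔞 • 𝔟 • I.1 := key I
    exact (congrArg (fun N => QuatModForm.mulUnit N (coeUnit B hα0)⁻¹) h2).symm.trans (hcancel I.1)

/-- At each prime `𝔞` is generated by one `ξ`, which can be cancelled. -/
theorem idealMul_le_iff {𝔞 : Ideal (𝓞 F)} (h𝔞 : 𝔞 ≠ ⊥) {I J : LeftIdeals R} :
    (J.idealMul 𝔞 h𝔞).1 ≤ (I.idealMul 𝔞 h𝔞).1 ↔ J.1 ≤ I.1 := by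
  refine ⟨fun h => ?_, fun h => Submodule.smul_mono le_rfl h⟩
  intro b hb
  refine mem_of_forall_locally_mem fun v => ?_
  obtain ⟨ξ, hξ, h0, -, hgen⟩ := exists_local_generator v h𝔞
  have hx := isLocalGenerator_smul v (I.isLocalGenerator_gen v) hξ h0 hgen
  obtain ⟨t, ht, r, hr, hrb⟩ := hx.exists_eq_mul _ (h (Submodule.smul_mem_smul hξ hb))
  refine ⟨t, ht, ?_⟩
  rw [Units.val_mul, mul_coeUnit, mul_smul_comm, smul_comm] at hrb
  have h1 : t • b = r * (I.gen v : B) := by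
    rw [← mul_coeUnit h0, ← mul_coeUnit h0] at hrb
    exact (Units.mul_left_inj _).1 hrb
  rw [h1]
  exact I.2.mul_mem r hr _ (I.isLocalGenerator_gen v).mem

theorem localIndex_idealMul_idealMul (v : HeightOneSpectrum (𝓞 F)) (I J : LeftIdeals R)
    {𝔞 : Ideal (𝓞 F)} (h𝔞 : 𝔞 ≠ ⊥) :
    localIndex v (I.idealMul 𝔞 h𝔞) (J.idealMul 𝔞 h𝔞) = localIndex v I J := by
  have h1 := localIndex_mul v I (I.idealMul 𝔞 h𝔞) (J.idealMul 𝔞 h𝔞)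
  rw [← localIndex_mul v I J (J.idealMul 𝔞 h𝔞), localIndex_idealMul, localIndex_idealMul,
    mul_comm] at h1
  exact mul_right_cancel₀ (pow_ne_zero _ (idealVal_ne_zero v h𝔞)) h1

theorem idealMul_mem_heckeSet_iff {𝔞 𝔪 : Ideal (𝓞 F)} (h𝔞 : 𝔞 ≠ ⊥) (h𝔪 : 𝔪 ≠ ⊥)
    {I J : LeftIdeals R} :
    J.idealMul 𝔞 h𝔞 ∈ heckeSet 𝔪 (I.idealMul 𝔞 h𝔞) ↔ J ∈ heckeSet 𝔪 I := by
  rw [mem_heckeSet_iff h𝔪, mem_heckeSet_iff h𝔪, idealMul_le_iff]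
  simp_rw [localIndex_idealMul_idealMul]

/-- Reindexing by `J ↦ 𝔞J` makes this a sum over ideals inside `𝔞I`, ready to be compared with a sum
over ideals inside `I`. -/
theorem idealAct_mul_hecke_cl {𝔞 𝔪 : Ideal (𝓞 F)} (h𝔞 : 𝔞 ≠ ⊥) (h𝔪 : 𝔪 ≠ ⊥)
    (I : LeftIdeals R) :
    (idealAct R 𝔞 h𝔞 * hecke R 𝔪) (Finsupp.single I.cl 1)
      = ∑ K ∈ (heckeSet_finite h𝔪 (I.idealMul 𝔞 h𝔞)).toFinset, Finsupp.single K.cl 1 := by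
  rw [Module.End.mul_apply, hecke_cl R h𝔪, map_sum]
  simp_rw [idealAct_cl]
  refine Finset.sum_bij (fun J _ => J.idealMul 𝔞 h𝔞) ?_ ?_ ?_ fun _ _ => rfl
  · intro J hJ
    rw [Set.Finite.mem_toFinset] at hJ ⊢
    exact (idealMul_mem_heckeSet_iff h𝔞 h𝔪).2 hJ
  · intro J _ K _ h
    exact (idealMul_bijective h𝔞).1 h
  · intro K hK
    obtain ⟨J, rfl⟩ := (idealMul_bijective h𝔞).2 K
    rw [Set.Finite.mem_toFinset] at hK
    exact ⟨J, (Set.Finite.mem_toFinset _).2 ((idealMul_mem_heckeSet_iff h𝔞 h𝔪).1 hK), rfl⟩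

end Hecke

/-! ### Reduced trace and norm -/

section ReducedNorm

theorem redTrace_add (x y : B) : redTrace F B (x + y) = redTrace F B x + redTrace F B y := by
  simp only [redTrace, ← add_div, ← map_add]
  congr 2
  ext; simp [add_mul]

theorem redTrace_smul (c : F) (x : B) : redTrace F B (c • x) = c * redTrace F B x := by
  have h : LinearMap.mulLeft F (c • x) = c • LinearMap.mulLeft F x := by ext; simp
  rw [redTrace, redTrace, h, map_smul, smul_eq_mul, mul_div_assoc]

theorem redTrace_mul_comm (x y : B) : redTrace F B (x * y) = redTrace F B (y * x) := by
  simp only [redTrace]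
  have h : ∀ a b : B, LinearMap.mulLeft F (a * b)
      = LinearMap.mulLeft F a * LinearMap.mulLeft F b := by
    intro a b; ext; simp
  rw [h, h, LinearMap.trace_mul_comm]

variable (F) in
/-- The standard involution of a quaternion algebra. -/
noncomputable def conj (x : B) : B := algebraMap F B (redTrace F B x) - x

variable (F) in
/-- The reduced norm of a quaternion algebra. -/
noncomputable def redNorm (x : B) : F := redTrace F B (x * conj F x) / 2

theorem redTrace_algEquiv {B' : Type*} [Ring B'] [Algebra F B'] (φ : B ≃ₐ[F] B') (x : B) :
    redTrace F B' (φ x) = redTrace F B x := by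
  rw [redTrace, redTrace, ← LinearMap.trace_conj' _ φ.toLinearEquiv]
  congr 2
  ext b
  simp [LinearEquiv.conj_apply]

theorem conj_algEquiv {B' : Type*} [Ring B'] [Algebra F B'] (φ : B ≃ₐ[F] B') (x : B) :
    conj F (φ x) = φ (conj F x) := by
  rw [conj, conj, redTrace_algEquiv, map_sub, AlgEquiv.commutes]

theorem redNorm_algEquiv {B' : Type*} [Ring B'] [Algebra F B'] (φ : B ≃ₐ[F] B') (x : B) :
    redNorm F (φ x) = redNorm F x := by
  rw [redNorm, redNorm, conj_algEquiv, ← map_mul, redTrace_algEquiv]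

/-! ### Trace, conjugation and norm in coordinates -/

section Quaternion

variable {a b : F}

theorem redTrace_quaternion (q : ℍ[F,a,b]) : redTrace F ℍ[F,a,b] q = 2 * q.re := by
  have h : LinearMap.trace F ℍ[F,a,b] (LinearMap.mulLeft F q) = 4 * q.re := by
    rw [LinearMap.trace_eq_matrix_trace F (QuaternionAlgebra.basisOneIJK a 0 b)]
    simp only [Matrix.trace, Matrix.diag, LinearMap.toMatrix_apply, Fin.sum_univ_four,
      QuaternionAlgebra.coe_basisOneIJK_repr]
    simp [QuaternionAlgebra.basisOneIJK]
    ring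
  rw [redTrace, h]
  ring

theorem conj_quaternion (q : ℍ[F,a,b]) : conj F q = star q := by
  rw [conj, redTrace_quaternion, QuaternionAlgebra.star_eq_two_re_sub]
  simp [QuaternionAlgebra.coe_algebraMap]

theorem redNorm_quaternion (q : ℍ[F,a,b]) : redNorm F q = (q * star q).re := by
  rw [redNorm, redTrace_quaternion, conj_quaternion]
  ring

theorem det_mulRight_quaternion (q : ℍ[F,a,b]) :
    LinearMap.det (LinearMap.mulRight F q) = (q * star q).re ^ 2 := by
  rw [← LinearMap.det_toMatrix (QuaternionAlgebra.basisOneIJK a 0 b)]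
  simp only [Matrix.det_succ_row_zero, Matrix.submatrix_apply, LinearMap.toMatrix_apply,
    QuaternionAlgebra.coe_basisOneIJK_repr]
  simp [Fin.sum_univ_succ, QuaternionAlgebra.basisOneIJK, Fin.succAbove]
  ring

end Quaternion

/-! ### Identities in an abstract quaternion algebra -/

variable (hB : IsQuaternionAlgebra F B)
include hB

theorem IsQuaternionAlgebra.finrank_eq : Module.finrank F B = 4 := by
  obtain ⟨a, b, -, -, ⟨φ⟩⟩ := hB
  rw [φ.toLinearEquiv.finrank_eq, QuaternionAlgebra.finrank_eq_four]

theorem IsQuaternionAlgebra.moduleFinite : Module.Finite F B :=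
  Module.finite_of_finrank_pos (by rw [hB.finrank_eq]; norm_num)

theorem IsQuaternionAlgebra.nontrivial : Nontrivial B :=
  Module.nontrivial_of_finrank_pos (R := F) (by rw [hB.finrank_eq]; norm_num)

theorem IsQuaternionAlgebra.mul_conj (x : B) : x * conj F x = algebraMap F B (redNorm F x) := by
  obtain ⟨a, b, -, -, ⟨φ⟩⟩ := hB
  apply φ.injective
  rw [map_mul, ← conj_algEquiv, AlgEquiv.commutes, ← redNorm_algEquiv φ, conj_quaternion,
    redNorm_quaternion]
  exact QuaternionAlgebra.mul_star_eq_coe _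

theorem IsQuaternionAlgebra.conj_mul_self (x : B) :
    conj F x * x = algebraMap F B (redNorm F x) := by
  rw [← hB.mul_conj, conj, sub_mul, mul_sub, Algebra.commutes]

theorem IsQuaternionAlgebra.conj_mul (x y : B) : conj F (x * y) = conj F y * conj F x := by
  obtain ⟨a, b, -, -, ⟨φ⟩⟩ := hB
  apply φ.injective
  rw [map_mul, ← conj_algEquiv, ← conj_algEquiv, ← conj_algEquiv, conj_quaternion,
    conj_quaternion, conj_quaternion, map_mul, star_mul]

/-- The source of the squares in the index condition: index `𝔪²` means that the ratio of local
generators has reduced norm generating `𝔪`. -/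
theorem IsQuaternionAlgebra.det_mulRight (x : B) :
    LinearMap.det (LinearMap.mulRight F x) = redNorm F x ^ 2 := by
  obtain ⟨a, b, -, -, ⟨φ⟩⟩ := hB
  rw [← redNorm_algEquiv φ, redNorm_quaternion, ← det_mulRight_quaternion,
    ← LinearMap.det_conj _ φ.toLinearEquiv]
  congr 1
  ext b : 1
  simp

theorem IsQuaternionAlgebra.redTrace_one : redTrace F B 1 = 2 := by
  obtain ⟨a, b, -, -, ⟨φ⟩⟩ := hB
  rw [← redTrace_algEquiv φ, map_one, redTrace_quaternion, QuaternionAlgebra.re_one, mul_one]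

theorem IsQuaternionAlgebra.algebraMap_injective : Function.Injective (algebraMap F B) :=
  have := hB.nontrivial
  (algebraMap F B).injective

theorem IsQuaternionAlgebra.redNorm_mul (x y : B) :
    redNorm F (x * y) = redNorm F x * redNorm F y := by
  apply hB.algebraMap_injective
  rw [← hB.mul_conj, hB.conj_mul, map_mul, mul_assoc, ← mul_assoc y, hB.mul_conj y,
    Algebra.commutes, ← mul_assoc, hB.mul_conj]

theorem IsQuaternionAlgebra.redNorm_one : redNorm F (1 : B) = 1 := by
  apply hB.algebraMap_injective
  rw [← hB.mul_conj, conj, hB.redTrace_one, map_one, one_mul, map_ofNat]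
  norm_num

theorem IsQuaternionAlgebra.redNorm_algebraMap (c : F) : redNorm F (algebraMap F B c) = c ^ 2 := by
  apply hB.algebraMap_injective
  rw [← hB.mul_conj, conj, Algebra.algebraMap_eq_smul_one, redTrace_smul, hB.redTrace_one,
    map_mul, map_pow, map_ofNat, ← Algebra.algebraMap_eq_smul_one]
  rw [mul_two, add_sub_cancel_right, pow_two]

theorem IsQuaternionAlgebra.redNorm_smul (c : F) (x : B) :
    redNorm F (c • x) = c ^ 2 * redNorm F x := by
  rw [Algebra.smul_def, hB.redNorm_mul, hB.redNorm_algebraMap]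

theorem IsQuaternionAlgebra.redTrace_algebraMap (c : F) :
    redTrace F B (algebraMap F B c) = c * 2 := by
  rw [Algebra.algebraMap_eq_smul_one, redTrace_smul, hB.redTrace_one]

theorem IsQuaternionAlgebra.redTrace_conj (x : B) : redTrace F B (conj F x) = redTrace F B x := by
  have h : conj F x + x = algebraMap F B (redTrace F B x) := sub_add_cancel _ _
  have h1 := congrArg (redTrace F B) h
  rw [redTrace_add, hB.redTrace_algebraMap] at h1
  linear_combination h1

theorem IsQuaternionAlgebra.redNorm_add (x y : B) :
    redNorm F (x + y) = redNorm F x + redNorm F y + redTrace F B (x * conj F y) := by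
  apply hB.algebraMap_injective
  have h1 : conj F (x * conj F y) = y * conj F x := by
    rw [hB.conj_mul]
    congr 1
    rw [conj, hB.redTrace_conj, conj]
    abel
  have h2 : algebraMap F B (redTrace F B (x * conj F y)) = x * conj F y + y * conj F x := by
    rw [← h1, add_comm]
    exact (sub_add_cancel _ _).symm
  have h3 : conj F (x + y) = conj F x + conj F y := by
    rw [conj, conj, conj, redTrace_add, map_add]
    abel
  rw [map_add, map_add, h2, ← hB.mul_conj, ← hB.mul_conj, ← hB.mul_conj, h3]
  noncomm_ring

theorem IsQuaternionAlgebra.redTrace_mul_conj (x y : B) :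
    redTrace F B (x * conj F y) = redTrace F B x * redTrace F B y - redTrace F B (x * y) := by
  rw [conj, mul_sub, sub_eq_add_neg, redTrace_add, ← neg_one_smul F (x * y), redTrace_smul,
    ← Algebra.commutes, ← Algebra.smul_def, redTrace_smul]
  ring

theorem IsQuaternionAlgebra.exists_unit {x : B} (h : redNorm F x ≠ 0) : ∃ y : Bˣ, (y : B) = x := by
  have h1 : algebraMap F B (redNorm F x)⁻¹ * algebraMap F B (redNorm F x) = 1 := by
    rw [← map_mul, inv_mul_cancel₀ h, map_one]
  refine ⟨⟨x, algebraMap F B (redNorm F x)⁻¹ * conj F x, ?_, ?_⟩, rfl⟩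
  · rw [← mul_assoc, ← Algebra.commutes, mul_assoc, hB.mul_conj, h1]
  · rw [mul_assoc, hB.conj_mul_self, h1]

end ReducedNorm

/-! ### Integrality of reduced trace and norm on an order -/

theorem exists_ne_zero_smul_mem {I : Submodule (𝓞 F) B}
    (h : Submodule.span F (I : Set B) = ⊤) (b : B) : ∃ c : 𝓞 F, c ≠ 0 ∧ c • b ∈ I := by
  have hb : b ∈ Submodule.span F (I : Set B) := h ▸ Submodule.mem_top
  refine Submodule.span_induction (p := fun b _ => ∃ c : 𝓞 F, c ≠ 0 ∧ c • b ∈ I) ?_ ?_ ?_ ?_ hb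
  · exact fun x hx => ⟨1, one_ne_zero, by rwa [one_smul]⟩
  · exact ⟨1, one_ne_zero, by simp⟩
  · rintro x y - - ⟨c, hc, hcx⟩ ⟨d, hd, hdy⟩
    refine ⟨c * d, mul_ne_zero hc hd, ?_⟩
    rw [smul_add]
    refine add_mem ?_ ?_
    · rw [mul_comm, mul_smul]
      exact I.smul_mem d hcx
    · rw [mul_smul]
      exact I.smul_mem c hdy
  · rintro a x - ⟨c, hc, hcx⟩
    obtain ⟨n, d, hd, rfl⟩ := IsFractionRing.div_surjective (A := 𝓞 F) a
    have hd0 : d ≠ 0 := nonZeroDivisors.ne_zero hd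
    refine ⟨c * d, mul_ne_zero hc hd0, ?_⟩
    have h1 : (c * d) • (algebraMap (𝓞 F) F n / algebraMap (𝓞 F) F d) • x = n • c • x := by
      rw [← algebraMap_smul F (c * d), ← algebraMap_smul F n (c • x), ← algebraMap_smul F c x,
        smul_smul, smul_smul, map_mul]
      have : algebraMap (𝓞 F) F d ≠ 0 := by simpa using hd0
      congr 1
      field_simp
    rw [h1]
    exact I.smul_mem n hcx

theorem isOrder_inf {R₁ R₂ : Subalgebra (𝓞 F) B} (h₁ : IsOrder R₁) (h₂ : IsOrder R₂) :
    IsOrder (R₁ ⊓ R₂) where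
  fg := by
    have hfin : Module.Finite (𝓞 F) (Subalgebra.toSubmodule R₁) := Module.Finite.iff_fg.2 h₁.fg
    exact isNoetherian_submodule.1
      (inferInstance : IsNoetherian (𝓞 F) (Subalgebra.toSubmodule R₁)) _
      (fun b hb => hb.1)
  span_eq_top := by
    rw [eq_top_iff]
    intro b _
    obtain ⟨c, hc, hcb⟩ := exists_ne_zero_smul_mem h₁.span_eq_top b
    obtain ⟨d, hd, hdb⟩ := exists_ne_zero_smul_mem h₂.span_eq_top b
    have h1 : (c * d) • b ∈ R₁ ⊓ R₂ := by
      refine ⟨?_, ?_⟩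
      · rw [mul_comm, mul_smul]
        exact R₁.smul_mem hcb d
      · rw [mul_smul]
        exact R₂.smul_mem hdb c
    have h2 : ((c * d : 𝓞 F) : F) ≠ 0 := by simpa using ⟨hc, hd⟩
    have h3 := Submodule.smul_mem (Submodule.span F ((Subalgebra.toSubmodule (R₁ ⊓ R₂)) : Set B))
      ((c * d : 𝓞 F) : F)⁻¹ (Submodule.subset_span h1)
    rwa [← algebraMap_smul F (c * d) b, smul_smul, inv_mul_cancel₀ h2, one_smul] at h3

theorem IsEichlerOrder.isOrder {R : Subalgebra (𝓞 F) B} (h : IsEichlerOrder R) : IsOrder R := by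
  obtain ⟨R₁, R₂, h₁, h₂, rfl⟩ := h
  exact isOrder_inf h₁.1 h₂.1

section Order

variable (hB : IsQuaternionAlgebra F B) {R : Subalgebra (𝓞 F) B} (hR : IsOrder R)
include hB hR

/-- Right multiplication by `r` preserves the lattice `R`, so its determinant, the square of the
norm, is integral; `𝓞 F` is integrally closed. -/
theorem IsOrder.exists_redNorm_eq {r : B} (hr : r ∈ R) :
    ∃ c : 𝓞 F, algebraMap (𝓞 F) F c = redNorm F r := by
  have := hB.moduleFinite
  obtain ⟨c, hc⟩ := det_mem_of_mapsTo hR (LinearMap.mulRight F r) fun x hx => R.mul_mem hx hr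
  rw [hB.det_mulRight] at hc
  have h1 : IsIntegral (𝓞 F) (redNorm F r) := by
    refine IsIntegral.of_pow two_pos ?_
    rw [← hc]
    exact isIntegral_algebraMap
  exact IsIntegrallyClosed.isIntegral_iff.1 h1

/-- Reduces to norms through `nrd(r + 1) = nrd(r) + 1 + trd(r)`. -/
theorem IsOrder.exists_redTrace_eq {r : B} (hr : r ∈ R) :
    ∃ c : 𝓞 F, algebraMap (𝓞 F) F c = redTrace F B r := by
  obtain ⟨a, ha⟩ := hR.exists_redNorm_eq hB hr
  obtain ⟨b, hb⟩ := hR.exists_redNorm_eq hB (R.add_mem hr R.one_mem)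
  have h1 : conj F (1 : B) = 1 := by
    rw [conj, hB.redTrace_one, map_ofNat]
    norm_num
  rw [hB.redNorm_add, h1, mul_one, hB.redNorm_one, ← ha] at hb
  refine ⟨b - a - 1, ?_⟩
  rw [map_sub, map_sub, hb, map_one]
  ring

theorem IsOrder.conj_mem {r : B} (hr : r ∈ R) : conj F r ∈ R := by
  obtain ⟨c, hc⟩ := hR.exists_redTrace_eq hB hr
  rw [conj, ← hc, ← IsScalarTower.algebraMap_apply]
  exact R.sub_mem (R.algebraMap_mem c) hr

end Order

/-! ### The reduction of an order at a prime not dividing its discriminant -/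

/-- `d` has an inverse modulo the maximal ideal `v`, and the error term sends `b` into `v.asIdeal •
I`. -/
theorem smul_mem_iff_of_notMem (v : HeightOneSpectrum (𝓞 F)) {V : Type*} [AddCommGroup V]
    [Module (𝓞 F) V] {I : Submodule (𝓞 F) V} {d : 𝓞 F} (hd : d ∉ v.asIdeal) {b : V}
    (hb : b ∈ I) (h : d • b ∈ v.asIdeal • I) : b ∈ v.asIdeal • I := by
  obtain ⟨e, q, hq, he⟩ := (v.isPrime.isMaximal v.ne_bot).exists_inv hd
  have h1 : b = e • d • b + q • b := by
    rw [← mul_smul, ← add_smul, he, one_smul]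
  rw [h1]
  exact add_mem (Submodule.smul_mem _ e h) (Submodule.smul_mem_smul hq hb)

/-- Four elements of `R` whose Gram determinant for the reduced trace is prime to `v`. -/
structure LocalBasis (v : HeightOneSpectrum (𝓞 F)) (R : Subalgebra (𝓞 F) B) where
  /-- the elements -/
  vec : Fin 4 → B
  vec_mem : ∀ i, vec i ∈ R
  /-- the Gram matrix -/
  gram : Matrix (Fin 4) (Fin 4) (𝓞 F)
  gram_eq : ∀ i j, algebraMap (𝓞 F) F (gram i j) = redTrace F B (vec i * vec j)
  det_notMem : gram.det ∉ v.asIdeal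

/-- If all Gram determinants lay in `v`, so would `D ^ 2`, and then `D`, since `v` is prime. -/
theorem exists_localBasis (hB : IsQuaternionAlgebra F B) {R : Subalgebra (𝓞 F) B}
    (hR : IsOrder R) {D : Ideal (𝓞 F)} (hD : IsDiscriminant R D) (v : HeightOneSpectrum (𝓞 F))
    (hv : ¬ v.asIdeal ∣ D) : Nonempty (LocalBasis v R) := by
  by_contra hempty
  apply hv
  rw [Ideal.dvd_iff_le]
  have hint : ∀ x : Fin 4 → B, (∀ i, x i ∈ R) → ∀ i j, ∃ c : 𝓞 F,
      algebraMap (𝓞 F) F c = redTrace F B (x i * x j) := fun x hx i j =>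
    hR.exists_redTrace_eq hB (R.mul_mem (hx i) (hx j))
  have hle : IsLocalization.coeSubmodule F (D ^ 2)
      ≤ IsLocalization.coeSubmodule F v.asIdeal := by
    rw [← hD]
    refine Submodule.span_le.2 ?_
    rintro _ ⟨x, hx, rfl⟩
    choose G hG using hint x hx
    have h1 : (Matrix.of fun i j => redTrace F B (x i * x j)).det
        = algebraMap (𝓞 F) F (Matrix.of G).det := by
      rw [RingHom.map_det]
      congr 1
      ext i j
      exact (hG i j).symm
    rw [h1]
    refine ⟨(Matrix.of G).det, ?_, rfl⟩
    by_contra hdet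
    exact hempty ⟨⟨x, hx, Matrix.of G, hG, hdet⟩⟩
  intro a ha
  obtain ⟨b, hb, hab⟩ := hle ⟨a ^ 2, Ideal.pow_mem_pow ha 2, rfl⟩
  rw [Algebra.linearMap_apply, Algebra.linearMap_apply] at hab
  have h2 : b = a ^ 2 := FaithfulSMul.algebraMap_injective (𝓞 F) F hab
  exact v.isPrime.mem_of_pow_mem 2 (h2 ▸ hb)

section Reduction

variable {v : HeightOneSpectrum (𝓞 F)} {R : Subalgebra (𝓞 F) B}

theorem redTrace_smul_int (c : 𝓞 F) (b : B) : redTrace F B (c • b) = c * redTrace F B b := by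
  rw [← algebraMap_smul F c b, redTrace_smul]

theorem mul_mem_smul_left {b s : B} (hb : b ∈ v.asIdeal • Subalgebra.toSubmodule R) (hs : s ∈ R) :
    s * b ∈ v.asIdeal • Subalgebra.toSubmodule R := by
  refine Submodule.smul_induction_on hb (fun a ha c hc => ?_) fun x y hx hy => ?_
  · rw [mul_smul_comm]
    exact Submodule.smul_mem_smul ha (R.mul_mem hs hc)
  · rw [mul_add]
    exact add_mem hx hy

theorem mul_mem_smul_right {b s : B} (hb : b ∈ v.asIdeal • Subalgebra.toSubmodule R) (hs : s ∈ R) :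
    b * s ∈ v.asIdeal • Subalgebra.toSubmodule R := by
  refine Submodule.smul_induction_on hb (fun a ha c hc => ?_) fun x y hx hy => ?_
  · rw [smul_mul_assoc]
    exact Submodule.smul_mem_smul ha (R.mul_mem hc hs)
  · rw [add_mul]
    exact add_mem hx hy

theorem exists_redTrace_mem (hB : IsQuaternionAlgebra F B) (hR : IsOrder R) {b : B}
    (hb : b ∈ v.asIdeal • Subalgebra.toSubmodule R) :
    ∃ c ∈ v.asIdeal, algebraMap (𝓞 F) F c = redTrace F B b := by
  refine Submodule.smul_induction_on hb (fun a ha c hc => ?_) ?_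
  · obtain ⟨t, ht⟩ := hR.exists_redTrace_eq hB hc
    exact ⟨a * t, Ideal.mul_mem_right _ _ ha, by rw [redTrace_smul_int, ← ht, map_mul]⟩
  · rintro x y ⟨c, hc, hcx⟩ ⟨d, hd, hdy⟩
    exact ⟨c + d, add_mem hc hd, by rw [redTrace_add, ← hcx, ← hdy, map_add]⟩

namespace LocalBasis

variable (L : LocalBasis v R)

theorem gram_comm (i j : Fin 4) : L.gram i j = L.gram j i := by
  refine FaithfulSMul.algebraMap_injective (𝓞 F) F ?_
  rw [L.gram_eq, L.gram_eq, redTrace_mul_comm]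

theorem redTrace_sum_mul (c : Fin 4 → F) (j : Fin 4) :
    redTrace F B ((∑ i, c i • L.vec i) * L.vec j)
      = ∑ i, algebraMap (𝓞 F) F (L.gram j i) * c i := by
  have hsum : ∀ s : Finset (Fin 4), redTrace F B ((∑ i ∈ s, c i • L.vec i) * L.vec j)
      = ∑ i ∈ s, algebraMap (𝓞 F) F (L.gram j i) * c i := by
    intro s
    induction s using Finset.induction_on with
    | empty =>
      rw [Finset.sum_empty, Finset.sum_empty, zero_mul, ← zero_smul F (1 : B), redTrace_smul,
        zero_mul]
    | insert i s hi ih =>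
      rw [Finset.sum_insert hi, Finset.sum_insert hi, add_mul, redTrace_add, ih, smul_mul_assoc,
        redTrace_smul, L.gram_comm, L.gram_eq, mul_comm]
  exact hsum _

theorem det_coe_ne_zero : (L.gram.map (algebraMap (𝓞 F) F)).det ≠ 0 := by
  have h : (L.gram.map (algebraMap (𝓞 F) F)).det = algebraMap (𝓞 F) F L.gram.det :=
    (RingHom.map_det _ _).symm
  rw [h]
  simpa using ne_zero_of_notMem v L.det_notMem

theorem eq_zero_of_redTrace (c : Fin 4 → F)
    (h : ∀ j, redTrace F B ((∑ i, c i • L.vec i) * L.vec j) = 0) : c = 0 := by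
  refine Matrix.eq_zero_of_mulVec_eq_zero L.det_coe_ne_zero (funext fun j => ?_)
  have h1 := h j
  rw [L.redTrace_sum_mul] at h1
  exact h1

theorem linearIndependent : LinearIndependent F L.vec := by
  refine Fintype.linearIndependent_iff.2 fun c hc => congrFun (L.eq_zero_of_redTrace c fun j => ?_)
  rw [hc, zero_mul, ← zero_smul F (1 : B), redTrace_smul, zero_mul]

theorem eq_sum (hB : IsQuaternionAlgebra F B) (b : B) :
    ∃ c : Fin 4 → F, b = ∑ i, c i • L.vec i := by
  have h := L.linearIndependent.span_eq_top_of_card_eq_finrank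
    (by rw [hB.finrank_eq, Fintype.card_fin])
  have hb : b ∈ Submodule.span F (Set.range L.vec) := h ▸ Submodule.mem_top
  obtain ⟨c, hc⟩ := (Submodule.mem_span_range_iff_exists_fun F).1 hb
  exact ⟨c, hc.symm⟩

/-- Cramer's rule: the traces `t` are the Gram matrix applied to the coordinates of `b`. -/
theorem det_smul_eq_sum (hB : IsQuaternionAlgebra F B) (b : B) (t : Fin 4 → 𝓞 F)
    (ht : ∀ j, algebraMap (𝓞 F) F (t j) = redTrace F B (b * L.vec j)) :
    L.gram.det • b = ∑ i, (L.gram.adjugate.mulVec t) i • L.vec i := by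
  obtain ⟨c, rfl⟩ := L.eq_sum hB b
  have hc : ∀ j, algebraMap (𝓞 F) F (t j) = ∑ i, algebraMap (𝓞 F) F (L.gram j i) * c i := by
    intro j
    rw [ht, L.redTrace_sum_mul]
  rw [← sub_eq_zero]
  have h1 : L.gram.det • ∑ i, c i • L.vec i - ∑ i, (L.gram.adjugate.mulVec t) i • L.vec i
      = ∑ i, (algebraMap (𝓞 F) F L.gram.det * c i
          - algebraMap (𝓞 F) F (L.gram.adjugate.mulVec t i)) • L.vec i := by
    rw [Finset.smul_sum, ← Finset.sum_sub_distrib]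
    refine Finset.sum_congr rfl fun i _ => ?_
    rw [sub_smul, mul_smul, ← algebraMap_smul F L.gram.det (c i • L.vec i),
      ← algebraMap_smul F (L.gram.adjugate.mulVec t i) (L.vec i)]
  have h2 : (fun i => algebraMap (𝓞 F) F L.gram.det * c i
      - algebraMap (𝓞 F) F (L.gram.adjugate.mulVec t i)) = 0 := by
    refine Matrix.eq_zero_of_mulVec_eq_zero L.det_coe_ne_zero (funext fun j => ?_)
    have h3 : (L.gram.mulVec (L.gram.adjugate.mulVec t)) j = L.gram.det * t j := by
      rw [Matrix.mulVec_mulVec, Matrix.mul_adjugate, Matrix.smul_mulVec, Matrix.one_mulVec]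
      rfl
    have h4 := congrArg (algebraMap (𝓞 F) F) h3
    rw [map_mul, hc j, Matrix.mulVec, dotProduct, map_sum] at h4
    simp only [map_mul] at h4
    rw [Matrix.mulVec, dotProduct]
    simp only [Matrix.map_apply, mul_sub, Finset.sum_sub_distrib, Pi.zero_apply]
    rw [h4, Finset.mul_sum, sub_eq_zero]
    exact Finset.sum_congr rfl fun i _ => by ring
  rw [h1]
  refine Finset.sum_eq_zero fun i _ => ?_
  have h3 := congrFun h2 i
  simp only [Pi.zero_apply] at h3
  rw [h3, zero_smul]

theorem exists_det_smul_eq_sum (hB : IsQuaternionAlgebra F B) (hR : IsOrder R) {r : B}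
    (hr : r ∈ R) : ∃ c : Fin 4 → 𝓞 F, L.gram.det • r = ∑ i, c i • L.vec i := by
  choose t ht using fun j => hR.exists_redTrace_eq hB (R.mul_mem hr (L.vec_mem j))
  exact ⟨_, L.det_smul_eq_sum hB r t ht⟩

theorem sum_mem (c : Fin 4 → 𝓞 F) : ∑ i, c i • L.vec i ∈ R :=
  R.sum_mem fun i _ => R.smul_mem (L.vec_mem i) (c i)

include L in
-- Nondegeneracy of the trace form on `R / 𝔭R`: by Cramer's rule the coordinates of `r` times the
-- Gram determinant lie in `v`.
theorem mem_smul_of_redTrace_mem (hB : IsQuaternionAlgebra F B) {r : B} (hr : r ∈ R)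
    (h : ∀ s ∈ R, ∃ c ∈ v.asIdeal, algebraMap (𝓞 F) F c = redTrace F B (r * s)) :
    r ∈ v.asIdeal • Subalgebra.toSubmodule R := by
  choose t ht htr using fun j => h (L.vec j) (L.vec_mem j)
  refine smul_mem_iff_of_notMem v L.det_notMem (I := Subalgebra.toSubmodule R) hr ?_
  rw [L.det_smul_eq_sum hB r t htr]
  refine Submodule.sum_mem _ fun i _ => Submodule.smul_mem_smul ?_ (L.vec_mem i)
  rw [Matrix.mulVec, dotProduct]
  exact Ideal.sum_mem _ fun j _ => Ideal.mul_mem_left _ _ (ht j)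

/-- Pairing with each `vec j` puts the Gram matrix times `c` into `v`; the adjugate then frees `c`.
This is independence of `vec` modulo `v`. -/
theorem mem_of_sum_mem_smul (hB : IsQuaternionAlgebra F B) (hR : IsOrder R) (c : Fin 4 → 𝓞 F)
    (h : ∑ i, c i • L.vec i ∈ v.asIdeal • Subalgebra.toSubmodule R) (i : Fin 4) :
    c i ∈ v.asIdeal := by
  have h1 : ∀ j, (L.gram.mulVec c) j ∈ v.asIdeal := by
    intro j
    obtain ⟨d, hd, hdt⟩ := exists_redTrace_mem hB hR (mul_mem_smul_right h (L.vec_mem j))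
    have h2 : ∑ i, c i • L.vec i = ∑ i, algebraMap (𝓞 F) F (c i) • L.vec i :=
      Finset.sum_congr rfl fun i _ => (algebraMap_smul F (c i) (L.vec i)).symm
    rw [h2, L.redTrace_sum_mul] at hdt
    have h3 : d = (L.gram.mulVec c) j := by
      apply FaithfulSMul.algebraMap_injective (𝓞 F) F
      rw [Matrix.mulVec, dotProduct, map_sum]
      simpa only [map_mul] using hdt
    exact h3 ▸ hd
  have h2 : L.gram.det * c i = (L.gram.adjugate.mulVec (L.gram.mulVec c)) i := by
    rw [Matrix.mulVec_mulVec, Matrix.adjugate_mul, Matrix.smul_mulVec, Matrix.one_mulVec]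
    rfl
  refine (v.isPrime.mem_or_mem (x := L.gram.det) ?_).resolve_left L.det_notMem
  rw [h2, Matrix.mulVec, dotProduct]
  exact Ideal.sum_mem _ fun j _ => Ideal.mul_mem_left _ _ (h1 j)

end LocalBasis

end Reduction

/-! ### Matrix units modulo a prime not dividing the discriminant -/

theorem IsQuaternionAlgebra.conj_conj (hB : IsQuaternionAlgebra F B) (x : B) :
    conj F (conj F x) = x := by
  rw [conj, hB.redTrace_conj, conj, sub_sub_cancel]

theorem conj_add_self (x : B) : conj F x + x = algebraMap F B (redTrace F B x) :=
  sub_add_cancel _ _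

section MatrixUnits

variable {v : HeightOneSpectrum (𝓞 F)} {R : Subalgebra (𝓞 F) B} (L : LocalBasis v R)
  (hB : IsQuaternionAlgebra F B) (hR : IsOrder R)

include hB in
-- Upper triangular coefficients avoid halving the polarization, so the form reduces modulo `v` even
-- in residue characteristic two.
theorem redNorm_sum_four (x : Fin 4 → B) (c : Fin 4 → F) :
    redNorm F (∑ i, c i • x i) = ∑ i, ∑ j, (if i = j then redNorm F (x i) else
      if i < j then redTrace F B (x i * conj F (x j)) else 0) * (c i * c j) := by
  have h : ∀ (a b : F) (y z : B), redTrace F B ((a • y) * conj F (b • z))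
      = redTrace F B (y * conj F z) * (a * b) := by
    intro a b y z
    have h1 : conj F (b • z) = b • conj F z := by
      rw [conj, conj, redTrace_smul, smul_sub, Algebra.smul_def b (algebraMap F B _), map_mul]
    rw [h1, smul_mul_smul_comm, redTrace_smul]
    ring
  simp only [Fin.sum_univ_four]
  simp only [hB.redNorm_add, add_mul, redTrace_add, h, hB.redNorm_smul]
  simp [Fin.lt_def, Fin.ext_iff]
  ring

include L hB hR in
-- Chevalley–Warning over the residue field: trace and norm have degrees adding up to `3 < 4` in
-- four variables, so the number of common zeros is divisible by the characteristic, and the origin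
-- is not the only one.
theorem exists_isotropic : ∃ u ∈ R, u ∉ v.asIdeal • Subalgebra.toSubmodule R ∧
    (∃ a ∈ v.asIdeal, algebraMap (𝓞 F) F a = redTrace F B u) ∧
    ∃ a ∈ v.asIdeal, algebraMap (𝓞 F) F a = redNorm F u := by
  classical
  have hmax : v.asIdeal.IsMaximal := v.isPrime.isMaximal v.ne_bot
  let _ : Field (𝓞 F ⧸ v.asIdeal) := Ideal.Quotient.field _
  have hfin : Finite (𝓞 F ⧸ v.asIdeal) := Ideal.finiteQuotientOfFreeOfNeBot _ v.ne_bot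
  let _ : Fintype (𝓞 F ⧸ v.asIdeal) := Fintype.ofFinite _
  choose t ht using fun i => hR.exists_redTrace_eq hB (L.vec_mem i)
  have hA : ∀ i j, ∃ a : 𝓞 F, algebraMap (𝓞 F) F a = if i = j then redNorm F (L.vec i) else
      if i < j then redTrace F B (L.vec i * conj F (L.vec j)) else 0 := by
    intro i j
    split_ifs
    · exact hR.exists_redNorm_eq hB (L.vec_mem i)
    · exact hR.exists_redTrace_eq hB (R.mul_mem (L.vec_mem i) (hR.conj_mem hB (L.vec_mem j)))
    · exact ⟨0, map_zero _⟩
  choose A hA using hA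
  let π := Ideal.Quotient.mk v.asIdeal
  let f₁ : MvPolynomial (Fin 4) (𝓞 F ⧸ v.asIdeal) :=
    ∑ i, MvPolynomial.C (π (t i)) * MvPolynomial.X i
  let f₂ : MvPolynomial (Fin 4) (𝓞 F ⧸ v.asIdeal) :=
    ∑ i, ∑ j, MvPolynomial.C (π (A i j)) * (MvPolynomial.X i * MvPolynomial.X j)
  have hf₁ : f₁.totalDegree ≤ 1 := by
    refine MvPolynomial.IsHomogeneous.totalDegree_le ?_
    refine MvPolynomial.IsHomogeneous.sum _ _ _ fun i _ => ?_
    exact (MvPolynomial.isHomogeneous_C _ _).mul (MvPolynomial.isHomogeneous_X _ _)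
  have hf₂ : f₂.totalDegree ≤ 2 := by
    refine MvPolynomial.IsHomogeneous.totalDegree_le ?_
    refine MvPolynomial.IsHomogeneous.sum _ _ _ fun i _ => ?_
    refine MvPolynomial.IsHomogeneous.sum _ _ _ fun j _ => ?_
    exact (MvPolynomial.isHomogeneous_C _ _).mul
      ((MvPolynomial.isHomogeneous_X _ _).mul (MvPolynomial.isHomogeneous_X _ _))
  have hdvd := char_dvd_card_solutions_of_add_lt (ringChar (𝓞 F ⧸ v.asIdeal))
    (f₁ := f₁) (f₂ := f₂) (by rw [Fintype.card_fin]; omega)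
  have hprime : (ringChar (𝓞 F ⧸ v.asIdeal)).Prime := CharP.char_is_prime (𝓞 F ⧸ v.asIdeal) _
  have hcard : 1 < Fintype.card {x : Fin 4 → 𝓞 F ⧸ v.asIdeal //
      MvPolynomial.eval x f₁ = 0 ∧ MvPolynomial.eval x f₂ = 0} := by
    refine hprime.one_lt.trans_le (Nat.le_of_dvd ?_ hdvd)
    exact Fintype.card_pos_iff.2 ⟨⟨0, by simp [f₁], by simp [f₂]⟩⟩
  obtain ⟨⟨x, hx₁, hx₂⟩, hne⟩ := Fintype.exists_ne_of_one_lt_card hcard ⟨0, by simp [f₁],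
    by simp [f₂]⟩
  have hx : x ≠ 0 := fun h => hne (Subtype.ext h)
  choose c hc using fun i => Ideal.Quotient.mk_surjective (x i)
  have hsum : ∑ i, c i • L.vec i = ∑ i, algebraMap (𝓞 F) F (c i) • L.vec i :=
    Finset.sum_congr rfl fun i _ => (algebraMap_smul F (c i) (L.vec i)).symm
  refine ⟨∑ i, c i • L.vec i, L.sum_mem c, fun h => hx (funext fun i => ?_), ?_, ?_⟩
  · rw [← hc i]
    exact Ideal.Quotient.eq_zero_iff_mem.2 (L.mem_of_sum_mem_smul hB hR c h i)
  · refine ⟨∑ i, t i * c i, ?_, ?_⟩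
    · rw [← Ideal.Quotient.eq_zero_iff_mem, ← hx₁, map_sum, map_sum]
      refine Finset.sum_congr rfl fun i _ => ?_
      rw [map_mul, map_mul, MvPolynomial.eval_C, MvPolynomial.eval_X, hc]
    · rw [map_sum, Fin.sum_univ_four, Fin.sum_univ_four]
      simp only [redTrace_add, redTrace_smul_int, map_mul, ht, mul_comm]
  · refine ⟨∑ i, ∑ j, A i j * (c i * c j), ?_, ?_⟩
    · rw [← Ideal.Quotient.eq_zero_iff_mem, ← hx₂, map_sum, map_sum]
      refine Finset.sum_congr rfl fun i _ => ?_
      rw [map_sum, map_sum]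
      refine Finset.sum_congr rfl fun j _ => ?_
      rw [map_mul, map_mul, map_mul, map_mul, MvPolynomial.eval_C, MvPolynomial.eval_X,
        MvPolynomial.eval_X, hc, hc]
    · rw [hsum, redNorm_sum_four hB]
      simp only [map_sum, map_mul, hA]

include L hB hR in
/-- `R / vR` contains elements `u, w` with `u² = 0`, `uw + wu = 1`. -/
theorem exists_matrix_units : ∃ u ∈ R, ∃ w ∈ R,
    u ∉ v.asIdeal • Subalgebra.toSubmodule R ∧
    u * u ∈ v.asIdeal • Subalgebra.toSubmodule R ∧
    u * w + w * u - 1 ∈ v.asIdeal • Subalgebra.toSubmodule R := by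
  obtain ⟨u, hu, hup, ⟨α, hα, htr⟩, β, hβ, hnm⟩ := exists_isotropic L hB hR
  obtain ⟨s, hs, hs'⟩ : ∃ s ∈ R,
      ¬ ∃ c ∈ v.asIdeal, algebraMap (𝓞 F) F c = redTrace F B (u * s) := by
    by_contra! h
    exact hup (L.mem_smul_of_redTrace_mem hB hu h)
  obtain ⟨d, hd⟩ := hR.exists_redTrace_eq hB (R.mul_mem hu hs)
  have hdv : d ∉ v.asIdeal := fun h => hs' ⟨d, h, hd⟩
  obtain ⟨e, q, hq, he⟩ := (v.isPrime.isMaximal v.ne_bot).exists_inv hdv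
  -- Normalized so that `trd(uy) = ed` is `1` modulo `v`.
  set y := e • s with hy
  have hyR : y ∈ R := R.smul_mem hs e
  obtain ⟨t, ht⟩ := hR.exists_redTrace_eq hB hyR
  have huy : redTrace F B (u * y) = algebraMap (𝓞 F) F (e * d) := by
    rw [hy, mul_smul_comm, redTrace_smul_int, ← hd, map_mul]
  have hzR : conj F y ∈ R := hR.conj_mem hB hyR
  have hcoe : ∀ (a : 𝓞 F) (b : B), algebraMap F B (algebraMap (𝓞 F) F a) * b = a • b := by
    intro a b
    rw [← Algebra.smul_def, algebraMap_smul]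
  have hcoe1 : ∀ a : 𝓞 F, algebraMap F B (algebraMap (𝓞 F) F a) = a • 1 := by
    intro a
    rw [← hcoe, mul_one]
  have hzy : redTrace F B (u * conj F y) = algebraMap (𝓞 F) F (α * t - e * d) := by
    rw [hB.redTrace_mul_conj, ← htr, ← ht, huy, map_sub, map_mul _ α t]
  have hone : (α * t - e * d + 1) ∈ v.asIdeal := by
    have h1 : α * t - e * d + 1 = α * t + q := by linear_combination -he
    rw [h1]
    exact add_mem (Ideal.mul_mem_right _ _ hα) hq
  have e3 : u * u ∈ v.asIdeal • Subalgebra.toSubmodule R := by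
    have h1 := hB.conj_mul_self u
    rw [conj, sub_mul, ← htr, ← hnm, hcoe, hcoe1] at h1
    have h2 : u * u = α • u - β • 1 := by rw [← h1]; abel
    rw [h2]
    exact sub_mem (Submodule.smul_mem_smul hα hu) (Submodule.smul_mem_smul hβ R.one_mem)
  have hcu : conj F u = α • 1 - u := by rw [conj, ← htr, hcoe1]
  have hmem : (α * t - e * d + 1) • (1 : B) - α • y ∈ v.asIdeal • Subalgebra.toSubmodule R :=
    sub_mem (Submodule.smul_mem_smul hone R.one_mem) (Submodule.smul_mem_smul hα hyR)
  have e1 : u * conj F y - y * u + 1 ∈ v.asIdeal • Subalgebra.toSubmodule R := by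
    have h1 := conj_add_self (F := F) (u * conj F y)
    rw [hB.conj_mul, hB.conj_conj, hzy, hcoe1, hcu, mul_sub, mul_smul_comm, mul_one] at h1
    have h2 : u * conj F y - y * u + 1 = (α * t - e * d + 1) • (1 : B) - α • y := by
      rw [add_smul, ← h1, one_smul]
      abel
    exact h2 ▸ hmem
  have e2 : conj F y * u - u * y + 1 ∈ v.asIdeal • Subalgebra.toSubmodule R := by
    have h1 := conj_add_self (F := F) (conj F y * u)
    rw [hB.conj_mul, hB.conj_conj, redTrace_mul_comm, hzy, hcoe1, hcu, sub_mul, smul_mul_assoc,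
      one_mul] at h1
    have h2 : conj F y * u - u * y + 1 = (α * t - e * d + 1) • (1 : B) - α • y := by
      rw [add_smul, ← h1, one_smul]
      abel
    exact h2 ▸ hmem
  -- With `w = -ȳuy`, modulo `v`: `yu = uȳ + 1` and `u² = 0` give `uw = uy` and `wu = -ȳu`, and `uy
  -- - ȳu = 1` by `e2`.
  refine ⟨u, hu, -(conj F y * u * y), R.neg_mem (R.mul_mem (R.mul_mem hzR hu) hyR), hup, e3,
    ?_⟩
  have h1 : u * -(conj F y * u * y) + -(conj F y * u * y) * u - 1
      = -(y * (u * u) * y) - (u * conj F y - y * u + 1) * (u * y)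
        - conj F y * (u * u) * conj F y - (conj F y * u - u * y + 1)
        + conj F y * u * (u * conj F y - y * u + 1) := by noncomm_ring
  rw [h1]
  exact add_mem (sub_mem (sub_mem (sub_mem
    (neg_mem (mul_mem_smul_right (mul_mem_smul_left e3 hyR) hyR))
    (mul_mem_smul_right e1 (R.mul_mem hu hyR)))
    (mul_mem_smul_right (mul_mem_smul_left e3 hzR) hzR)) e2)
    (mul_mem_smul_left e1 (R.mul_mem hzR hu))

end MatrixUnits

/-! ### Ideals of index `𝔭²` -/

section Uniformizer

variable {v : HeightOneSpectrum (𝓞 F)}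

theorem idealVal_self_lt_one : idealVal v v.asIdeal < 1 := idealVal_lt_one v le_rfl

theorem valuation_le_of_lt_one {a : F} (h : v.valuation F a < 1) :
    v.valuation F a ≤ idealVal v v.asIdeal := by
  obtain ⟨s, hs, c, hc⟩ := (valuation_le_one_iff v).1 h.le
  rw [← valuation_smul v hs, hc] at h ⊢
  exact valuation_coe_le_idealVal v ((v.valuation_lt_one_iff_mem c).1 h)

theorem mem_of_valuation_lt_one {c : 𝓞 F} {a : F} (hc : algebraMap (𝓞 F) F c = a)
    (ha : v.valuation F a < 1) : c ∈ v.asIdeal := by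
  subst hc
  exact (v.valuation_lt_one_iff_mem (K := F) c).1 ha

/-- Allows any integer `ϖ` with the valuation of a uniformizer, since it is also applied to reduced
norms. -/
theorem exists_smul_eq_smul_of_mem {V : Type*} [AddCommGroup V] [Module (𝓞 F) V]
    {I : Submodule (𝓞 F) V} {ϖ : 𝓞 F}
    (hϖ : v.valuation F (algebraMap (𝓞 F) F ϖ) = idealVal v v.asIdeal) {b : V}
    (hb : b ∈ v.asIdeal • I) : ∃ s ∉ v.asIdeal, ∃ c ∈ I, s • b = ϖ • c := by
  have h0 : algebraMap (𝓞 F) F ϖ ≠ 0 := by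
    rw [← Valuation.ne_zero_iff (v.valuation F), hϖ]
    exact idealVal_ne_zero v v.ne_bot
  refine Submodule.smul_induction_on hb (fun α hα c hc => ?_) ?_
  · have h1 : v.valuation F (algebraMap (𝓞 F) F α) ≤ v.valuation F (algebraMap (𝓞 F) F ϖ) :=
      hϖ ▸ valuation_coe_le_idealVal v hα
    obtain ⟨s, hs, t, hst⟩ := (valuation_le_iff v h0).1 h1
    rw [Algebra.smul_def, Algebra.smul_def, ← map_mul, ← map_mul] at hst
    have h2 : s * α = t * ϖ := FaithfulSMul.algebraMap_injective (𝓞 F) F hst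
    exact ⟨s, hs, t • c, I.smul_mem t hc, by rw [← mul_smul, h2, mul_comm, mul_smul]⟩
  · rintro x y ⟨s, hs, c, hc, h1⟩ ⟨t, ht, d, hd, h2⟩
    refine ⟨s * t, notMem_mul v hs ht, t • c + s • d, add_mem (I.smul_mem t hc) (I.smul_mem s hd),
      ?_⟩
    rw [smul_add, smul_add, mul_comm s t, mul_smul, h1, mul_comm t s, mul_smul, h2, smul_comm t,
      smul_comm s]

end Uniformizer

/-! ### The norm form on `I` and the modules between `𝔭I` and `I` -/

section Between

variable {v : HeightOneSpectrum (𝓞 F)} {R : Subalgebra (𝓞 F) B}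
  (hB : IsQuaternionAlgebra F B) {I : Submodule (𝓞 F) B} {x : Bˣ}

/-- The reduced norm relative to the generator `x`. -/
noncomputable def relNorm (F : Type*) [Field F] [NumberField F] {B : Type*} [Ring B] [Algebra F B]
    (x : Bˣ) (b : B) : F := redNorm F (b * ((x⁻¹ : Bˣ) : B))

/-- The polarization of `relNorm`. -/
noncomputable def relPolar (F : Type*) [Field F] [NumberField F] {B : Type*} [Ring B] [Algebra F B]
    (x : Bˣ) (b c : B) : F := redTrace F B (b * ((x⁻¹ : Bˣ) : B) * conj F (c * ((x⁻¹ : Bˣ) : B)))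

theorem smul_int_eq (t : 𝓞 F) (b : B) : t • b = algebraMap (𝓞 F) F t • b :=
  (algebraMap_smul F t b).symm

theorem conj_smul (c : F) (b : B) : conj F (c • b) = c • conj F b := by
  rw [conj, conj, redTrace_smul, smul_sub, Algebra.smul_def c (algebraMap F B _), map_mul]

include hB

theorem relNorm_add (b c : B) :
    relNorm F x (b + c) = relNorm F x b + relNorm F x c + relPolar F x b c := by
  rw [relNorm, add_mul, hB.redNorm_add]
  rfl

theorem relNorm_mul (a b : B) : relNorm F x (a * b) = redNorm F a * relNorm F x b := by
  rw [relNorm, mul_assoc, hB.redNorm_mul]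
  rfl

theorem relNorm_smul (a : 𝓞 F) (b : B) :
    relNorm F x (a • b) = algebraMap (𝓞 F) F a ^ 2 * relNorm F x b := by
  rw [smul_int_eq, relNorm, smul_mul_assoc, hB.redNorm_smul]
  rfl

omit hB in
theorem relPolar_smul (a : 𝓞 F) (b c : B) :
    relPolar F x b (a • c) = algebraMap (𝓞 F) F a * relPolar F x b c := by
  rw [smul_int_eq, relPolar, smul_mul_assoc, conj_smul, mul_smul_comm, redTrace_smul]
  rfl

theorem relNorm_self : relNorm F x (x : B) = 1 := by
  rw [relNorm, Units.mul_inv, hB.redNorm_one]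

theorem valuation_relNorm_smul {t : 𝓞 F} (ht : t ∉ v.asIdeal) (b : B) :
    v.valuation F (relNorm F x (t • b)) = v.valuation F (relNorm F x b) := by
  rw [relNorm_smul hB, map_mul, map_pow]
  erw [valuation_coe_eq_one v ht]
  rw [one_pow, one_mul]

theorem valuation_relNorm_of_smul_eq {t : 𝓞 F} (ht : t ∉ v.asIdeal) {b r : B}
    (h : t • b = r * x) : v.valuation F (relNorm F x b) = v.valuation F (redNorm F r) := by
  rw [← valuation_relNorm_smul hB ht, h, relNorm_mul hB, relNorm_self hB, mul_one]

theorem valuation_redNorm_le_one (hR : IsOrder R) {r : B} (hr : r ∈ R) :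
    v.valuation F (redNorm F r) ≤ 1 := by
  obtain ⟨c, hc⟩ := hR.exists_redNorm_eq hB hr
  exact hc ▸ v.valuation_le_one c

variable (hx : IsLocalGenerator v R I x) (hR : IsOrder R)
include hx hR

theorem valuation_relNorm_le_one {b : B} (hb : b ∈ I) : v.valuation F (relNorm F x b) ≤ 1 := by
  obtain ⟨t, ht, r, hr, h⟩ := hx.exists_eq_mul b hb
  rw [valuation_relNorm_of_smul_eq hB ht h]
  exact valuation_redNorm_le_one hB hR hr

theorem valuation_relPolar_le_one {b c : B} (hb : b ∈ I) (hc : c ∈ I) :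
    v.valuation F (relPolar F x b c) ≤ 1 := by
  have h : relPolar F x b c = relNorm F x (b + c) - (relNorm F x b + relNorm F x c) := by
    rw [relNorm_add hB]; ring
  rw [h]
  exact Valuation.map_sub_le _ (valuation_relNorm_le_one hB hx hR (add_mem hb hc))
    (Valuation.map_add_le _ (valuation_relNorm_le_one hB hx hR hb)
      (valuation_relNorm_le_one hB hx hR hc))

theorem valuation_relNorm_le_of_mem {b : B} (hb : b ∈ v.asIdeal • I) :
    v.valuation F (relNorm F x b) ≤ idealVal v v.asIdeal ^ 2 := by
  obtain ⟨ϖ, -, -, hval, -⟩ := exists_uniformizer v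
  obtain ⟨s, hs, c, hc, h⟩ := exists_smul_eq_smul_of_mem hval.symm hb
  rw [← valuation_relNorm_smul hB hs, h, relNorm_smul hB, map_mul, map_pow,
    ← RingOfIntegers.coe_eq_algebraMap, ← hval]
  exact mul_le_of_le_one_right' (valuation_relNorm_le_one hB hx hR hc)

theorem valuation_relPolar_lt_one_of_mem {b c : B} (hb : b ∈ I) (hc : c ∈ v.asIdeal • I) :
    v.valuation F (relPolar F x b c) < 1 := by
  obtain ⟨ϖ, -, -, hval, -⟩ := exists_uniformizer v
  obtain ⟨s, hs, d, hd, h⟩ := exists_smul_eq_smul_of_mem hval.symm hc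
  have h1 : v.valuation F (relPolar F x b (s • c)) = v.valuation F (relPolar F x b c) := by
    rw [relPolar_smul, map_mul]
    erw [valuation_coe_eq_one v hs]
    rw [one_mul]
  rw [← h1, h, relPolar_smul, map_mul, ← RingOfIntegers.coe_eq_algebraMap, ← hval]
  exact (mul_le_of_le_one_right' (valuation_relPolar_le_one hB hx hR hb hd)).trans_lt
    idealVal_self_lt_one

omit hB hR in
theorem mul_mem_smul_of_mem_smul (hI : ∀ r ∈ R, ∀ b ∈ I, r * b ∈ I) {r b : B}
    (hr : r ∈ v.asIdeal • Subalgebra.toSubmodule R) (hb : b ∈ I) : r * b ∈ v.asIdeal • I := by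
  refine Submodule.smul_induction_on hr (fun a ha c hc => ?_) fun x y hx hy => ?_
  · rw [smul_mul_assoc]
    exact Submodule.smul_mem_smul ha (hI c hc b hb)
  · rw [add_mul]
    exact add_mem hx hy

omit hB hR in
theorem mem_smul_of_mul_mem_smul {r : B} (hr : r ∈ R) (h : r * x ∈ v.asIdeal • I) :
    r ∈ v.asIdeal • Subalgebra.toSubmodule R := by
  obtain ⟨ϖ, hϖ, -, hval, -⟩ := exists_uniformizer v
  obtain ⟨s, hs, c, hc, h⟩ := exists_smul_eq_smul_of_mem hval.symm h
  obtain ⟨t, ht, q, hq, h2⟩ := hx.exists_eq_mul c hc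
  refine smul_mem_iff_of_notMem v (notMem_mul v ht hs) (I := Subalgebra.toSubmodule R) hr ?_
  have h3 : (t * s) • r = ϖ • q := by
    rw [← Units.mul_left_inj x, smul_mul_assoc, smul_mul_assoc, ← h2, mul_smul, h, smul_comm]
  rw [h3]
  exact Submodule.smul_mem_smul hϖ hq

/-- Nondegeneracy of the norm form on `I / 𝔭I`: testing against `s̄x` turns the polarization into
the trace pairing with `s` on `R`. -/
theorem mem_smul_of_valuation_relPolar_lt_one (L : LocalBasis v R)
    (hI : ∀ r ∈ R, ∀ b ∈ I, r * b ∈ I) {b : B} (hb : b ∈ I)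
    (h : ∀ c ∈ I, v.valuation F (relPolar F x b c) < 1) : b ∈ v.asIdeal • I := by
  obtain ⟨t, ht, r, hr, hrb⟩ := hx.exists_eq_mul b hb
  refine smul_mem_iff_of_notMem v ht hb ?_
  rw [hrb]
  refine mul_mem_smul_of_mem_smul hx hI (L.mem_smul_of_redTrace_mem hB hr fun s hs => ?_) hx.mem
  obtain ⟨a, ha⟩ := hR.exists_redTrace_eq hB (R.mul_mem hr hs)
  refine ⟨a, mem_of_valuation_lt_one ha ?_, ha⟩
  have h1 : redTrace F B (r * s) = algebraMap (𝓞 F) F t * relPolar F x b (conj F s * x) := by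
    have h2 : r = t • b * ((x⁻¹ : Bˣ) : B) := by rw [hrb, Units.mul_inv_cancel_right]
    rw [relPolar, Units.mul_inv_cancel_right, hB.conj_conj, h2, smul_mul_assoc, smul_mul_assoc,
      redTrace_smul_int]
  rw [h1, map_mul]
  refine (mul_le_of_le_one_left' (v.valuation_le_one t)).trans_lt ?_
  exact h _ (hI _ (hR.conj_mem hB hs) _ hx.mem)

variable {J : Submodule (𝓞 F) B}

/-- Otherwise `x`, of relative norm one, would be `b + c` with `b ∈ J` and `c ∈ 𝔭I`, but norms and
cross term all have valuation below one. -/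
theorem sup_smul_ne_of_valuation_relNorm_lt_one (hJ : J ≤ I)
    (h : ∀ b ∈ J, v.valuation F (relNorm F x b) < 1) : J ⊔ v.asIdeal • I ≠ I := by
  intro heq
  have hmem := hx.mem
  rw [← heq] at hmem
  obtain ⟨b, hb, c, hc, hbc⟩ := Submodule.mem_sup.1 hmem
  have h1 := relNorm_self hB (F := F) (x := x)
  rw [← hbc, relNorm_add hB] at h1
  have h2 : v.valuation F 1 < 1 := by
    rw [← h1]
    refine Valuation.map_add_lt _ (Valuation.map_add_lt _ (h b hb) ?_) ?_
    · exact (valuation_relNorm_le_of_mem hB hx hR hc).trans_lt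
        (pow_lt_one' idealVal_self_lt_one two_ne_zero)
    · exact valuation_relPolar_lt_one_of_mem hB hx hR (hJ hb) hc
  rw [map_one] at h2
  exact lt_irrefl _ h2

/-- An element `rx` of unit norm would generate `I` at `v`, since `r̄r` is then a unit there; away
from `v`, `𝔭I ≤ J` already gives agreement. -/
theorem valuation_relNorm_lt_one_of_ne (hmul : ∀ r ∈ R, ∀ b ∈ J, r * b ∈ J)
    (hle : v.asIdeal • I ≤ J) (hJ : J ≤ I) (hne : J ≠ I) {b : B} (hb : b ∈ J) :
    v.valuation F (relNorm F x b) < 1 := by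
  refine lt_of_le_of_ne (valuation_relNorm_le_one hB hx hR (hJ hb)) fun h1 => hne ?_
  obtain ⟨t, ht, r, hr, hrb⟩ := hx.exists_eq_mul b (hJ hb)
  rw [valuation_relNorm_of_smul_eq hB ht hrb] at h1
  obtain ⟨n, hn⟩ := hR.exists_redNorm_eq hB hr
  rw [← hn, v.valuation_eq_one_iff_notMem] at h1
  have hnx : n • (x : B) ∈ J := by
    have h2 : n • (x : B) = t • (conj F r * b) := by
      rw [← mul_smul_comm, hrb, ← mul_assoc, hB.conj_mul_self, ← hn, smul_int_eq, Algebra.smul_def]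
    rw [h2]
    exact J.smul_mem t (hmul _ (hR.conj_mem hB hr) b hb)
  refine le_antisymm hJ fun c hc => mem_of_forall_locally_mem fun w => ?_
  by_cases hw : w = v
  · subst hw
    obtain ⟨s, hs, q, hq, hqc⟩ := hx.exists_eq_mul c hc
    refine ⟨n * s, notMem_mul w h1 hs, ?_⟩
    rw [mul_smul, hqc, ← mul_smul_comm]
    exact hmul q hq _ hnx
  · obtain ⟨s, hs, hsw⟩ := exists_notMem_of_ne hw
    exact ⟨s, hsw, hle (Submodule.smul_mem_smul hs hc)⟩

/-- Take `j ∈ J` outside `𝔭I`. If its norm is too divisible, nondegeneracy gives `c` with unit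
polarization against `j`, and in the norm of `j + ϖc` the cross term dominates. -/
theorem exists_valuation_relNorm_eq (L : LocalBasis v R) (hI : ∀ r ∈ R, ∀ b ∈ I, r * b ∈ I)
    (hmul : ∀ r ∈ R, ∀ b ∈ J, r * b ∈ J)
    (hle : v.asIdeal • I ≤ J) (hJ : J ≤ I) (hne : J ≠ I) (hne' : J ≠ v.asIdeal • I) :
    ∃ j ∈ J, v.valuation F (relNorm F x j) = idealVal v v.asIdeal := by
  obtain ⟨j, hj, hjp⟩ : ∃ j ∈ J, j ∉ v.asIdeal • I := by
    by_contra! h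
    exact hne' (le_antisymm h hle)
  have h1 := valuation_le_of_lt_one (valuation_relNorm_lt_one_of_ne hB hx hR hmul hle hJ hne hj)
  rcases h1.eq_or_lt with h1 | h1
  · exact ⟨j, hj, h1⟩
  obtain ⟨c, hc, h2⟩ : ∃ c ∈ I, ¬ v.valuation F (relPolar F x j c) < 1 := by
    by_contra! h
    exact hjp (mem_smul_of_valuation_relPolar_lt_one hB hx hR L hI (hJ hj) h)
  have h3 : v.valuation F (relPolar F x j c) = 1 :=
    le_antisymm (valuation_relPolar_le_one hB hx hR (hJ hj) hc) (not_lt.1 h2)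
  obtain ⟨ϖ, hϖ, -, hval, -⟩ := exists_uniformizer v
  have hϖc : ϖ • c ∈ v.asIdeal • I := Submodule.smul_mem_smul hϖ hc
  refine ⟨j + ϖ • c, add_mem hj (hle hϖc), ?_⟩
  have h4 : v.valuation F (relNorm F x j + relNorm F x (ϖ • c)) < idealVal v v.asIdeal := by
    refine Valuation.map_add_lt _ h1 ((valuation_relNorm_le_of_mem hB hx hR hϖc).trans_lt ?_)
    rw [pow_two]
    exact mul_lt_of_lt_one_right (zero_lt_iff.2 (idealVal_ne_zero v v.ne_bot)) idealVal_self_lt_one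
  have h5 : v.valuation F (relPolar F x j (ϖ • c)) = idealVal v v.asIdeal := by
    rw [relPolar_smul, map_mul, h3, mul_one, hval]
  rw [relNorm_add hB, Valuation.map_add_eq_of_lt_right _ (h4.trans_eq h5.symm), h5]

/-- Up to multipliers, `b = qx` and `j = rx`. Norms on `J` lie in `𝔭` locally, hence so do
polarizations; thus `trd(qr̄a) ∈ 𝔭` for all `a ∈ R`, and `qr̄ ∈ 𝔭R`. Since `nrd(r) = n` is a
uniformizer, `qr̄ = na` locally; multiplying by `r` and cancelling `n` gives `q = ar`. -/
theorem isLocalGenerator_of_valuation_relNorm_eq (L : LocalBasis v R)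
    (hmul : ∀ r ∈ R, ∀ b ∈ J, r * b ∈ J)
    (hle : v.asIdeal • I ≤ J) (hJ : J ≤ I) (hne : J ≠ I) {j : Bˣ} (hj : (j : B) ∈ J)
    (h : v.valuation F (relNorm F x (j : B)) = idealVal v v.asIdeal) :
    IsLocalGenerator v R J j where
  mem := hj
  exists_eq_mul b hb := by
    obtain ⟨t, ht, r, hr, hrj⟩ := hx.exists_eq_mul j (hJ hj)
    obtain ⟨s, hs, q, hq, hqb⟩ := hx.exists_eq_mul b (hJ hb)
    obtain ⟨n, hn⟩ := hR.exists_redNorm_eq hB hr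
    rw [valuation_relNorm_of_smul_eq hB ht hrj, ← hn] at h
    have hn0 : n ≠ 0 := by
      rintro rfl
      rw [map_zero, map_zero] at h
      exact idealVal_ne_zero v v.ne_bot h.symm
    have hmem : q * conj F r ∈ v.asIdeal • Subalgebra.toSubmodule R := by
      refine L.mem_smul_of_redTrace_mem hB (R.mul_mem hq (hR.conj_mem hB hr)) fun a ha => ?_
      obtain ⟨c, hc⟩ := hR.exists_redTrace_eq hB
        (R.mul_mem (R.mul_mem hq (hR.conj_mem hB hr)) ha)
      refine ⟨c, mem_of_valuation_lt_one hc ?_, hc⟩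
      have h1 : redTrace F B (q * conj F r * a) = relPolar F x (a * (s • b)) (t • (j : B)) := by
        rw [hqb, hrj, relPolar, Units.mul_inv_cancel_right, ← mul_assoc, Units.mul_inv_cancel_right,
          redTrace_mul_comm, mul_assoc]
      have hab : a * (s • b) ∈ J := hmul a ha _ (J.smul_mem s hb)
      have htj : t • (j : B) ∈ J := J.smul_mem t hj
      have hlt : ∀ c ∈ J, v.valuation F (relNorm F x c) < 1 := fun c hc =>
        valuation_relNorm_lt_one_of_ne hB hx hR hmul hle hJ hne hc
      have h2 := relNorm_add hB (F := F) (x := x) (a * (s • b)) (t • (j : B))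
      rw [h1, ← sub_eq_iff_eq_add'.2 h2]
      exact Valuation.map_sub_lt _ (hlt _ (add_mem hab htj))
        (Valuation.map_add_lt _ (hlt _ hab) (hlt _ htj))
    obtain ⟨u, hu, a, ha, hua⟩ := exists_smul_eq_smul_of_mem h hmem
    have h3 : u • q = a * r := by
      have h4 : (u • q) * (coeUnit B hn0 : B) = (a * r) * (coeUnit B hn0 : B) := by
        rw [mul_coeUnit, mul_coeUnit, ← smul_mul_assoc n, ← hua, smul_mul_assoc, mul_assoc,
          hB.conj_mul_self, ← hn, ← Algebra.commutes, ← Algebra.smul_def, algebraMap_smul, smul_comm]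
      exact (Units.mul_left_inj _).1 h4
    refine ⟨u * s, notMem_mul v hu hs, t • a, R.smul_mem ha t, ?_⟩
    rw [mul_smul, hqb, ← smul_mul_assoc, h3, mul_assoc, ← hrj, smul_mul_assoc, mul_smul_comm]

end Between

namespace LeftIdeals

variable [Module.Finite F B] {v : HeightOneSpectrum (𝓞 F)} {R : Subalgebra (𝓞 F) B}
  (hB : IsQuaternionAlgebra F B) (hR : IsOrder R)

include hB in
theorem localIndex_eq_relNorm {I J : LeftIdeals R} {x y : Bˣ} (hx : IsLocalGenerator v R I.1 x)
    (hy : IsLocalGenerator v R J.1 y) :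
    localIndex v I J = v.valuation F (relNorm F x (y : B)) ^ 2 := by
  rw [localIndex_eq v hx hy, hB.det_mulRight, map_pow, Units.val_mul, hB.redNorm_mul, mul_comm,
    ← hB.redNorm_mul, relNorm]

include hB hR

/-- At `v` an element whose relative norm is a uniformizer generates `J`; at the other primes `J`
agrees with `I`. -/
theorem exists_mem_heckeSet_of_between (L : LocalBasis v R) {I : LeftIdeals R}
    {J : Submodule (𝓞 F) B} (hmul : ∀ r ∈ R, ∀ b ∈ J, r * b ∈ J) (hle : v.asIdeal • I.1 ≤ J)
    (hJ : J ≤ I.1) (hne : J ≠ I.1) (hne' : J ≠ v.asIdeal • I.1) :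
    ∃ J' ∈ heckeSet v.asIdeal I, J'.1 = J := by
  have hx := I.isLocalGenerator_gen v
  obtain ⟨j, hj, hval⟩ := exists_valuation_relNorm_eq hB hx hR L I.2.mul_mem hmul hle hJ hne hne'
  have hj0 : redNorm F j ≠ 0 := by
    intro h0
    rw [relNorm, hB.redNorm_mul, h0, zero_mul, map_zero] at hval
    exact idealVal_ne_zero v v.ne_bot hval.symm
  obtain ⟨j, rfl⟩ := hB.exists_unit hj0
  have hgen := isLocalGenerator_of_valuation_relNorm_eq hB hx hR L hmul hle hJ hne hj
    hval
  have haway : ∀ w ≠ v, ∀ b ∈ I.1, ∃ s ∉ w.asIdeal, s • b ∈ J := by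
    intro w hw b hb
    obtain ⟨s, hs, hsw⟩ := exists_notMem_of_ne hw
    exact ⟨s, hsw, hle (Submodule.smul_mem_smul hs hb)⟩
  have hinv : IsInvertibleLeftIdeal R J := by
    refine isInvertibleLeftIdeal_of_le hJ hmul (I.2.smul v.ne_bot).isLattice hle fun w => ?_
    by_cases hw : w = v
    · subst hw
      exact Or.inl ⟨j, hgen⟩
    · exact Or.inr (haway w hw)
  refine ⟨⟨J, hinv⟩, (mem_heckeSet_iff v.ne_bot).2 ⟨hJ, fun w => ?_⟩, rfl⟩
  by_cases hw : w = v
  · subst hw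
    rw [localIndex_eq_relNorm hB hx (J := ⟨J, hinv⟩) hgen, hval]
  · obtain ⟨s, hs, hsw⟩ := exists_notMem_of_ne hw
    rw [idealVal_eq_one w hs hsw, one_pow]
    exact localIndex_eq_one w hJ (haway w hw)

theorem valuation_relNorm_lt_one_of_localIndex {I K : LeftIdeals R} {x : Bˣ}
    (hx : IsLocalGenerator v R I.1 x) (h : localIndex v I K < 1) {b : B} (hb : b ∈ K.1) :
    v.valuation F (relNorm F x b) < 1 := by
  have hy := K.isLocalGenerator_gen v
  rw [localIndex_eq_relNorm hB hx hy] at h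
  obtain ⟨t, ht, r, hr, hrb⟩ := hy.exists_eq_mul b hb
  rw [← valuation_relNorm_smul hB ht, hrb, relNorm_mul hB, map_mul]
  refine (mul_le_of_le_one_left' (valuation_redNorm_le_one hB hR hr)).trans_lt ?_
  by_contra! h1
  exact not_lt_of_ge (one_le_pow_of_one_le' h1 2) h

/-- At `v` the generator of `J` is `rx` with `nrd(r)` a uniformizer, and `nrd(r)x = r̄(rx)` lies in
`J`. Elsewhere the index is trivial. -/
theorem smul_le_of_mem_heckeSet {I J : LeftIdeals R} (hJ : J ∈ heckeSet v.asIdeal I) :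
    v.asIdeal • I.1 ≤ J.1 := by
  rw [mem_heckeSet_iff v.ne_bot] at hJ
  have hx := I.isLocalGenerator_gen v
  have hy := J.isLocalGenerator_gen v
  intro b hb
  refine mem_of_forall_locally_mem fun w => ?_
  by_cases hw : w = v
  · subst hw
    have hval : w.valuation F (relNorm F (I.gen w) (J.gen w : B)) = idealVal w w.asIdeal := by
      have h1 := hJ.2 w
      rw [localIndex_eq_relNorm hB hx hy] at h1
      exact (pow_left_inj₀ zero_le zero_le two_ne_zero).1 h1
    obtain ⟨t, ht, r, hr, hrj⟩ := hx.exists_eq_mul _ (hJ.1 hy.mem)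
    obtain ⟨n, hn⟩ := hR.exists_redNorm_eq hB hr
    rw [valuation_relNorm_of_smul_eq hB ht hrj, ← hn] at hval
    obtain ⟨s, hs, c, hc, hsb⟩ := exists_smul_eq_smul_of_mem hval hb
    obtain ⟨u, hu, q, hq, hqc⟩ := hx.exists_eq_mul c hc
    refine ⟨u * s, notMem_mul w hu hs, ?_⟩
    have h2 : (u * s) • b = (q * conj F r) * (t • (J.gen w : B)) := by
      rw [mul_smul, hsb, smul_comm, hqc, hrj, mul_assoc, ← mul_assoc (conj F r), hB.conj_mul_self,
        ← hn, ← Algebra.smul_def, algebraMap_smul, mul_smul_comm]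
    rw [h2]
    exact J.2.mul_mem _ (R.mul_mem hq (hR.conj_mem hB hr)) _ (J.1.smul_mem t hy.mem)
  · obtain ⟨s, hs, hsw⟩ := exists_notMem_of_ne hw
    have h1 : localIndex w I J = 1 := by rw [hJ.2, idealVal_eq_one w hs hsw, one_pow]
    exact exists_smul_mem_of_localIndex_eq_one w hJ.1 h1 (Submodule.smul_le_right hb)

omit hR in
-- The index `𝔭²` differs from those of `I` and `𝔭I`, which are `1` and `𝔭⁴`.
theorem ne_of_mem_heckeSet {I J : LeftIdeals R} (hJ : J ∈ heckeSet v.asIdeal I) :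
    J.1 ≠ I.1 ∧ J.1 ≠ v.asIdeal • I.1 := by
  rw [mem_heckeSet_iff v.ne_bot] at hJ
  have hlt : idealVal v v.asIdeal ^ 2 < 1 := pow_lt_one' idealVal_self_lt_one two_ne_zero
  have h1 := hJ.2 v
  constructor
  · intro h
    have h2 : J = I := Subtype.ext h
    rw [h2, localIndex_self] at h1
    exact hlt.ne h1.symm
  · intro h
    have h2 : J = I.idealMul v.asIdeal v.ne_bot := Subtype.ext h
    rw [h2, localIndex_idealMul, hB.finrank_eq] at h1
    have h3 : idealVal v v.asIdeal ^ 2 * idealVal v v.asIdeal ^ 2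
        = idealVal v v.asIdeal ^ 2 * 1 := by
      rw [← pow_add, h1, mul_one]
    exact hlt.ne (mul_left_cancel₀ (pow_ne_zero 2 (idealVal_ne_zero v v.ne_bot)) h3)

end LeftIdeals

/-! ### Submodules stable under matrix units -/

section StableSubmodules

variable {k V : Type*} [Field k] [AddCommGroup V] [Module k V] {U W : Module.End k V}
  (hU : U * U = 0) (hUW : U * W + W * U = 1)

include hUW in
theorem eq_add_of_matrix_units (x : V) : x = U (W x) + W (U x) :=
  (LinearMap.congr_fun hUW x).symm

include hU hUW

/-- The relations make kernel and range of `U` coincide, so rank–nullity halves the dimension. -/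
theorem finrank_ker_of_matrix_units (h : Module.finrank k V = 4) :
    Module.finrank k (LinearMap.ker U) = 2 := by
  have hfin : FiniteDimensional k V := Module.finite_of_finrank_pos (by omega)
  have hrange : LinearMap.range U = LinearMap.ker U := by
    refine le_antisymm ?_ fun x hx => ?_
    · rintro _ ⟨y, rfl⟩
      exact LinearMap.congr_fun hU y
    · rw [LinearMap.mem_ker] at hx
      refine ⟨W x, ?_⟩
      conv_rhs => rw [eq_add_of_matrix_units hUW x, hx, map_zero, add_zero]
  have h1 := LinearMap.finrank_range_add_finrank_ker U
  rw [hrange] at h1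
  omega

/-- In `x = U(Wx) + W(Ux)` both `U(Wx)` and `Ux` lie in `ker U`, so a stable subspace is recovered
from its part in `ker U`. -/
theorem le_of_inf_ker_le {J J' : Submodule k V} (hJU : ∀ x ∈ J, U x ∈ J) (hJW : ∀ x ∈ J, W x ∈ J)
    (hJ' : ∀ x ∈ J', W x ∈ J') (h : ∀ x ∈ J, U x = 0 → x ∈ J') : J ≤ J' := by
  intro x hx
  have hUU : ∀ y, U (U y) = 0 := LinearMap.congr_fun hU
  rw [eq_add_of_matrix_units hUW x]
  exact add_mem (h _ (hJU _ (hJW x hx)) (hUU _)) (hJ' _ (h _ (hJU x hx) (hUU _)))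

theorem finrank_comap_ker (h : Module.finrank k V = 4) {J : Submodule k V}
    (hJU : ∀ x ∈ J, U x ∈ J) (hJW : ∀ x ∈ J, W x ∈ J) (hbot : J ≠ ⊥) (htop : J ≠ ⊤) :
    Module.finrank k (J.comap (LinearMap.ker U).subtype) = 1 := by
  have hfin : FiniteDimensional k V := Module.finite_of_finrank_pos (by omega)
  have hker := finrank_ker_of_matrix_units hU hUW h
  have h1 : J.comap (LinearMap.ker U).subtype ≠ ⊤ := by
    intro h1
    refine htop (top_le_iff.1 (le_of_inf_ker_le hU hUW (fun _ _ => trivial) (fun _ _ => trivial)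
      hJW fun x _ hx => ?_))
    have h2 : (⟨x, hx⟩ : LinearMap.ker U) ∈ J.comap (LinearMap.ker U).subtype := h1 ▸ trivial
    exact h2
  have h2 : J.comap (LinearMap.ker U).subtype ≠ ⊥ := by
    intro h2
    refine hbot (le_bot_iff.1 (le_of_inf_ker_le hU hUW hJU hJW (by simp) fun x hx hx0 => ?_))
    have h3 : (⟨x, hx0⟩ : LinearMap.ker U) ∈ J.comap (LinearMap.ker U).subtype := hx
    rw [h2, Submodule.mem_bot] at h3
    exact congrArg Subtype.val h3
  have h3 := Submodule.finrank_lt h1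
  have h4 := Submodule.one_le_finrank_iff.2 h2
  omega

end StableSubmodules

/-! ### The quotient `I / 𝔭I` -/

noncomputable instance residueField (v : HeightOneSpectrum (𝓞 F)) : Field (𝓞 F ⧸ v.asIdeal) :=
  have : v.asIdeal.IsMaximal := v.isPrime.isMaximal v.ne_bot
  Ideal.Quotient.field v.asIdeal

theorem card_residueField (v : HeightOneSpectrum (𝓞 F)) :
    Nat.card (𝓞 F ⧸ v.asIdeal) = Ideal.absNorm v.asIdeal := rfl

/-- The reduction `I / 𝔭I`. -/
abbrev Reduction (v : HeightOneSpectrum (𝓞 F)) (I : Submodule (𝓞 F) B) : Type _ :=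
  I ⧸ (v.asIdeal • ⊤ : Submodule (𝓞 F) I)

section Reduction

variable (v : HeightOneSpectrum (𝓞 F)) {R : Subalgebra (𝓞 F) B} {I : Submodule (𝓞 F) B}

/-- The class of `b ∈ I` in `I / 𝔭I`. -/
def redMk (b : B) (hb : b ∈ I) : Reduction v I := Submodule.Quotient.mk ⟨b, hb⟩

theorem redMk_surjective (z : Reduction v I) : ∃ b, ∃ hb : b ∈ I, redMk v b hb = z := by
  obtain ⟨⟨b, hb⟩, h⟩ := Submodule.Quotient.mk_surjective _ z
  exact ⟨b, hb, h⟩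

theorem redMk_eq_zero {b : B} (hb : b ∈ I) : redMk v b hb = 0 ↔ b ∈ v.asIdeal • I := by
  rw [redMk, Submodule.Quotient.mk_eq_zero, Submodule.mem_smul_top_iff]

theorem redMk_eq_iff {b c : B} (hb : b ∈ I) (hc : c ∈ I) :
    redMk v b hb = redMk v c hc ↔ b - c ∈ v.asIdeal • I := by
  rw [redMk, redMk, Submodule.Quotient.eq, Submodule.mem_smul_top_iff]
  rfl

theorem redMk_add {b c : B} (hb : b ∈ I) (hc : c ∈ I) :
    redMk v b hb + redMk v c hc = redMk v (b + c) (add_mem hb hc) := rfl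

theorem mk_smul_redMk (a : 𝓞 F) {b : B} (hb : b ∈ I) :
    Ideal.Quotient.mk v.asIdeal a • redMk v b hb = redMk v (a • b) (I.smul_mem a hb) := rfl

/-- The image in `I / 𝔭I` of a submodule `J`. -/
def redImage (I J : Submodule (𝓞 F) B) : Submodule (𝓞 F ⧸ v.asIdeal) (Reduction v I) where
  carrier := {z | ∃ b, ∃ hb : b ∈ I, b ∈ J ∧ redMk v b hb = z}
  zero_mem' := ⟨0, zero_mem _, zero_mem _, rfl⟩
  add_mem' := by
    rintro _ _ ⟨b, hb, hbJ, rfl⟩ ⟨c, hc, hcJ, rfl⟩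
    exact ⟨b + c, add_mem hb hc, add_mem hbJ hcJ, rfl⟩
  smul_mem' := by
    rintro a _ ⟨b, hb, hbJ, rfl⟩
    obtain ⟨a, rfl⟩ := Ideal.Quotient.mk_surjective a
    exact ⟨a • b, I.smul_mem a hb, J.smul_mem a hbJ, rfl⟩

theorem redMk_mem_redImage {J : Submodule (𝓞 F) B} (hJ : v.asIdeal • I ≤ J) {b : B} (hb : b ∈ I) :
    redMk v b hb ∈ redImage v I J ↔ b ∈ J := by
  refine ⟨?_, fun h => ⟨b, hb, h, rfl⟩⟩
  rintro ⟨c, hc, hcJ, h⟩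
  rw [redMk_eq_iff] at h
  rw [← sub_sub_cancel c b]
  exact sub_mem hcJ (hJ h)

theorem redImage_ne_bot {J : Submodule (𝓞 F) B} (hJ : v.asIdeal • I ≤ J) (hJI : J ≤ I)
    (hne : J ≠ v.asIdeal • I) : redImage v I J ≠ ⊥ := by
  intro h
  refine hne (le_antisymm (fun b hb => ?_) hJ)
  have h1 := (redMk_mem_redImage v hJ (hJI hb)).2 hb
  rwa [h, Submodule.mem_bot, redMk_eq_zero] at h1

theorem redImage_ne_top {J : Submodule (𝓞 F) B} (hJ : v.asIdeal • I ≤ J) (hJI : J ≤ I)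
    (hne : J ≠ I) : redImage v I J ≠ ⊤ := by
  intro h
  refine hne (le_antisymm hJI fun b hb => ?_)
  rw [← redMk_mem_redImage v hJ hb, h]
  trivial

variable (hI : ∀ r ∈ R, ∀ b ∈ I, r * b ∈ I)

/-- Left multiplication by `r ∈ R` on `I / 𝔭I`. -/
noncomputable def redMul (r : B) (hr : r ∈ R) :
    Module.End (𝓞 F ⧸ v.asIdeal) (Reduction v I) :=
  LinearMap.extendScalarsOfSurjective Ideal.Quotient.mk_surjective
    (Submodule.mapQ _ _ ((LinearMap.mulLeft (𝓞 F) r).restrict (p := I) (q := I) (hI r hr)) (by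
      rw [← Submodule.map_le_iff_le_comap, Submodule.map_smul'']
      exact Submodule.smul_mono le_rfl le_top))

theorem redMul_mem_redImage {J : Submodule (𝓞 F) B} (hmul : ∀ r ∈ R, ∀ b ∈ J, r * b ∈ J) {r : B}
    (hr : r ∈ R) : ∀ z ∈ redImage v I J, redMul v hI r hr z ∈ redImage v I J := by
  rintro _ ⟨b, hb, hbJ, rfl⟩
  exact ⟨r * b, hI r hr b hb, hmul r hr b hbJ, rfl⟩

include hI in
-- The classes of `vec i * x` form a basis: independent by `mem_of_sum_mem_smul`, spanning by
-- Cramer's rule with an invertible determinant.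
theorem finrank_reduction (hB : IsQuaternionAlgebra F B) (hR : IsOrder R) (L : LocalBasis v R)
    {x : Bˣ} (hx : IsLocalGenerator v R I x) :
    Module.finrank (𝓞 F ⧸ v.asIdeal) (Reduction v I) = 4 := by
  let e : Fin 4 → Reduction v I := fun i =>
    redMk v (L.vec i * x) (hI _ (L.vec_mem i) _ hx.mem)
  have hsum : ∀ c : Fin 4 → 𝓞 F, ∑ i, Ideal.Quotient.mk v.asIdeal (c i) • e i
      = redMk v ((∑ i, c i • L.vec i) * x) (hI _ (L.sum_mem c) _ hx.mem) := by
    intro c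
    simp only [Fin.sum_univ_four, e, mk_smul_redMk, redMk_add, add_mul, smul_mul_assoc]
  have hli : LinearIndependent (𝓞 F ⧸ v.asIdeal) e := by
    refine Fintype.linearIndependent_iff.2 fun g hg i => ?_
    choose c hc using fun i => Ideal.Quotient.mk_surjective (g i)
    obtain rfl : (fun i => Ideal.Quotient.mk v.asIdeal (c i)) = g := funext hc
    rw [hsum, redMk_eq_zero] at hg
    exact Ideal.Quotient.eq_zero_iff_mem.2 (L.mem_of_sum_mem_smul hB hR c
      (mem_smul_of_mul_mem_smul hx (L.sum_mem c) hg) i)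
  have hspan : ⊤ ≤ Submodule.span (𝓞 F ⧸ v.asIdeal) (Set.range e) := by
    intro z _
    obtain ⟨b, hb, rfl⟩ := redMk_surjective v z
    obtain ⟨t, ht, r, hr, hrb⟩ := hx.exists_eq_mul b hb
    obtain ⟨c, hc⟩ := L.exists_det_smul_eq_sum hB hR hr
    have hne : Ideal.Quotient.mk v.asIdeal (L.gram.det * t) ≠ 0 := fun h =>
      notMem_mul v L.det_notMem ht (Ideal.Quotient.eq_zero_iff_mem.1 h)
    have h1 : Ideal.Quotient.mk v.asIdeal (L.gram.det * t) • redMk v b hb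
        ∈ Submodule.span (𝓞 F ⧸ v.asIdeal) (Set.range e) := by
      have h2 : Ideal.Quotient.mk v.asIdeal (L.gram.det * t) • redMk v b hb
          = ∑ i, Ideal.Quotient.mk v.asIdeal (c i) • e i := by
        rw [hsum, mk_smul_redMk]
        congr 1
        rw [mul_smul, hrb, ← smul_mul_assoc, hc]
      rw [h2]
      exact Submodule.sum_mem _ fun i _ =>
        Submodule.smul_mem _ _ (Submodule.subset_span ⟨i, rfl⟩)
    exact (Submodule.smul_mem_iff _ hne).1 h1
  rw [Module.finrank_eq_card_basis (Module.Basis.mk hli hspan), Fintype.card_fin]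

end Reduction

/-! ### The number of ideals of index `𝔭²` -/

namespace LeftIdeals

variable [Module.Finite F B] {v : HeightOneSpectrum (𝓞 F)} {R : Subalgebra (𝓞 F) B}
  (hB : IsQuaternionAlgebra F B) (hR : IsOrder R)

include hB hR

/-- The norm of `b` is not a unit at `v`, since otherwise `ub ∈ 𝔭I` would force `u ∈ 𝔭R`. Hence `Rb
+ 𝔭I` lies strictly between `𝔭I` and `I`. -/
theorem exists_mem_heckeSet_of_mul_mem (L : LocalBasis v R) (I : LeftIdeals R) {u : B} (hu : u ∈ R)
    (hup : u ∉ v.asIdeal • Subalgebra.toSubmodule R) {b : B} (hb : b ∈ I.1)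
    (hbp : b ∉ v.asIdeal • I.1) (hub : u * b ∈ v.asIdeal • I.1) :
    ∃ J ∈ heckeSet v.asIdeal I, b ∈ J.1 := by
  have hx := I.isLocalGenerator_gen v
  have hN : v.valuation F (relNorm F (I.gen v) b) < 1 := by
    refine lt_of_le_of_ne (valuation_relNorm_le_one hB hx hR hb) fun h1 => hup ?_
    obtain ⟨t, ht, r, hr, hrb⟩ := hx.exists_eq_mul b hb
    rw [valuation_relNorm_of_smul_eq hB ht hrb] at h1
    obtain ⟨n, hn⟩ := hR.exists_redNorm_eq hB hr
    rw [← hn, v.valuation_eq_one_iff_notMem] at h1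
    have h2 : u * r ∈ v.asIdeal • Subalgebra.toSubmodule R := by
      refine mem_smul_of_mul_mem_smul hx (R.mul_mem hu hr) ?_
      rw [mul_assoc, ← hrb, mul_smul_comm]
      exact Submodule.smul_mem _ t hub
    refine smul_mem_iff_of_notMem v h1 (I := Subalgebra.toSubmodule R) hu ?_
    have h3 : n • u = u * r * conj F r := by
      rw [mul_assoc, hB.mul_conj, ← hn, ← Algebra.commutes, ← Algebra.smul_def, algebraMap_smul]
    rw [h3]
    exact mul_mem_smul_right h2 (hR.conj_mem hB hr)
  let K : Submodule (𝓞 F) B := (Subalgebra.toSubmodule R).map (LinearMap.mulRight (𝓞 F) b)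
  have hbK : b ∈ K := ⟨1, R.one_mem, one_mul b⟩
  have hKI : K ≤ I.1 := by
    rintro _ ⟨a, ha, rfl⟩
    exact I.2.mul_mem a ha b hb
  have hKmul : ∀ r ∈ R, ∀ c ∈ K, r * c ∈ K := by
    rintro r hr _ ⟨a, ha, rfl⟩
    exact ⟨r * a, R.mul_mem hr ha, mul_assoc r a b⟩
  have hKN : ∀ c ∈ K, v.valuation F (relNorm F (I.gen v) c) < 1 := by
    rintro _ ⟨a, ha, rfl⟩
    rw [LinearMap.mulRight_apply, relNorm_mul hB, map_mul]
    exact (mul_le_of_le_one_left' (valuation_redNorm_le_one hB hR ha)).trans_lt hN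
  have hne := sup_smul_ne_of_valuation_relNorm_lt_one hB hx hR hKI hKN
  obtain ⟨J, hJ, hJK⟩ := exists_mem_heckeSet_of_between hB hR L (J := K ⊔ v.asIdeal • I.1)
    (by
      intro r hr c hc
      obtain ⟨k, hk, d, hd, rfl⟩ := Submodule.mem_sup.1 hc
      rw [mul_add]
      exact Submodule.add_mem_sup (hKmul r hr k hk) ((I.2.smul v.ne_bot).mul_mem r hr d hd))
    le_sup_right (sup_le hKI Submodule.smul_le_right) hne
    (fun h => hbp (h ▸ Submodule.mem_sup_left hbK))
  exact ⟨J, hJ, hJK ▸ Submodule.mem_sup_left hbK⟩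

/-- `J` is matched with the line that its image in `I / 𝔭I` cuts out of the plane `ker U`;
injectivity is `le_of_inf_ker_le`, and `exists_mem_heckeSet_of_mul_mem` realizes every line. -/
theorem ncard_heckeSet_prime (L : LocalBasis v R) (I : LeftIdeals R) :
    (heckeSet v.asIdeal I).ncard = Ideal.absNorm v.asIdeal + 1 := by
  obtain ⟨u, hu, w, hw, hup, huu, huw⟩ := exists_matrix_units L hB hR
  have hx := I.isLocalGenerator_gen v
  have hI := I.2.mul_mem
  set U := redMul v hI u hu
  set W := redMul v hI w hw
  have hU : U * U = 0 := by
    refine LinearMap.ext fun z => ?_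
    obtain ⟨b, hb, rfl⟩ := redMk_surjective v z
    refine (redMk_eq_zero v (hI u hu _ (hI u hu b hb))).2 ?_
    rw [← mul_assoc]
    exact mul_mem_smul_of_mem_smul hx hI huu hb
  have hUW : U * W + W * U = 1 := by
    refine LinearMap.ext fun z => ?_
    obtain ⟨b, hb, rfl⟩ := redMk_surjective v z
    refine (redMk_eq_iff v (add_mem (hI u hu _ (hI w hw b hb)) (hI w hw _ (hI u hu b hb))) hb).2 ?_
    have h1 : u * (w * b) + w * (u * b) - b = (u * w + w * u - 1) * b := by noncomm_ring
    rw [h1]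
    exact mul_mem_smul_of_mem_smul hx hI huw hb
  have hdim := finrank_reduction v hI hB hR L hx
  have hfin : FiniteDimensional (𝓞 F ⧸ v.asIdeal) (Reduction v I.1) :=
    Module.finite_of_finrank_pos (by omega)
  have hkfin : Finite (𝓞 F ⧸ v.asIdeal) := Ideal.finiteQuotientOfFreeOfNeBot _ v.ne_bot
  let Φ : heckeSet v.asIdeal I → {H : Submodule (𝓞 F ⧸ v.asIdeal) (LinearMap.ker U) //
      Module.finrank (𝓞 F ⧸ v.asIdeal) H = 1} := fun J =>
    ⟨(redImage v I.1 J.1.1).comap (LinearMap.ker U).subtype, by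
      have hle := smul_le_of_mem_heckeSet hB hR J.2
      have hne := ne_of_mem_heckeSet hB J.2
      exact finrank_comap_ker hU hUW hdim (redMul_mem_redImage v hI J.1.2.mul_mem hu)
        (redMul_mem_redImage v hI J.1.2.mul_mem hw) (redImage_ne_bot v hle J.2.1 hne.2)
        (redImage_ne_top v hle J.2.1 hne.1)⟩
  have hle : ∀ J K : heckeSet v.asIdeal I, Φ J = Φ K → J.1.1 ≤ K.1.1 := by
    intro J K h b hb
    have hJ := smul_le_of_mem_heckeSet hB hR J.2
    have hK := smul_le_of_mem_heckeSet hB hR K.2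
    have h1 : redImage v I.1 J.1.1 ≤ redImage v I.1 K.1.1 := by
      refine le_of_inf_ker_le hU hUW (redMul_mem_redImage v hI J.1.2.mul_mem hu)
        (redMul_mem_redImage v hI J.1.2.mul_mem hw) (redMul_mem_redImage v hI K.1.2.mul_mem hw)
        fun z hz hz0 => ?_
      have h2 : (⟨z, hz0⟩ : LinearMap.ker U) ∈ (Φ J).1 := hz
      rw [h] at h2
      exact h2
    exact (redMk_mem_redImage v hK (J.2.1 hb)).1 (h1 ((redMk_mem_redImage v hJ (J.2.1 hb)).2 hb))
  have hbij : Function.Bijective Φ := by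
    refine ⟨fun J K h => Subtype.ext (Subtype.ext (le_antisymm (hle J K h) (hle K J h.symm))), ?_⟩
    rintro ⟨H, hH⟩
    have hHne : H ≠ ⊥ := Submodule.one_le_finrank_iff.1 hH.ge
    obtain ⟨⟨z, hz⟩, hzH, hz0⟩ := Submodule.exists_mem_ne_zero_of_ne_bot hHne
    obtain ⟨b, hb, rfl⟩ := redMk_surjective v z
    have hbp : b ∉ v.asIdeal • I.1 := fun h => hz0 (Subtype.ext ((redMk_eq_zero v hb).2 h))
    have hub : u * b ∈ v.asIdeal • I.1 := (redMk_eq_zero v (hI u hu b hb)).1 hz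
    obtain ⟨J, hJ, hbJ⟩ := exists_mem_heckeSet_of_mul_mem hB hR L I hu hup hb hbp hub
    refine ⟨⟨J, hJ⟩, Subtype.ext ?_⟩
    have hspan : ∀ H' : Submodule (𝓞 F ⧸ v.asIdeal) (LinearMap.ker U),
        Module.finrank (𝓞 F ⧸ v.asIdeal) H' = 1 → (⟨redMk v b hb, hz⟩ : LinearMap.ker U) ∈ H' →
        Submodule.span (𝓞 F ⧸ v.asIdeal) {(⟨redMk v b hb, hz⟩ : LinearMap.ker U)} = H' := by
      intro H' hH' hmem
      refine Submodule.eq_of_le_of_finrank_eq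
        ((Submodule.span_singleton_le_iff_mem _ _).2 hmem) ?_
      rw [hH', finrank_span_singleton hz0]
    exact (hspan _ (Φ ⟨J, hJ⟩).2 ⟨b, hb, hbJ, rfl⟩).symm.trans (hspan H hH hzH)
  have hcard := Nat.card_eq_of_bijective Φ hbij
  rw [← Nat.card_congr (Projectivization.equivSubmodule (𝓞 F ⧸ v.asIdeal) (LinearMap.ker U)),
    Projectivization.card_of_finrank_two _ _ (finrank_ker_of_matrix_units hU hUW hdim),
    card_residueField] at hcard
  exact hcard

end LeftIdeals

/-! ### The Hecke relation at a prime -/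

section HeckeRelation

open LeftIdeals

variable [Module.Finite F B] {v : HeightOneSpectrum (𝓞 F)} {R : Subalgebra (𝓞 F) B}
  (hB : IsQuaternionAlgebra F B) (hR : IsOrder R)

include hB hR

theorem numBetween_of_le (L : LocalBasis v R) {I K : LeftIdeals R} (hK : K.1 ≤ v.asIdeal • I.1) :
    numBetween v.asIdeal I K = Ideal.absNorm v.asIdeal + 1 := by
  rw [numBetween, ← ncard_heckeSet_prime hB hR L I]
  congr 1
  exact Set.sep_eq_self_iff_mem_true.2 fun J hJ => hK.trans (smul_le_of_mem_heckeSet hB hR hJ)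

/-- `K + 𝔭I` is strictly intermediate, and any other candidate contains it with the same index. -/
theorem numBetween_of_not_le (L : LocalBasis v R) {I K : LeftIdeals R} (hKI : K.1 ≤ I.1)
    (hindex : localIndex v I K < 1) (hK : ¬ K.1 ≤ v.asIdeal • I.1) :
    numBetween v.asIdeal I K = 1 := by
  have hx := I.isLocalGenerator_gen v
  obtain ⟨J, hJ, hJK⟩ := exists_mem_heckeSet_of_between hB hR L (J := K.1 ⊔ v.asIdeal • I.1)
    (by
      intro r hr c hc
      obtain ⟨k, hk, d, hd, rfl⟩ := Submodule.mem_sup.1 hc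
      rw [mul_add]
      exact Submodule.add_mem_sup (K.2.mul_mem r hr k hk) ((I.2.smul v.ne_bot).mul_mem r hr d hd))
    le_sup_right (sup_le hKI Submodule.smul_le_right)
    (sup_smul_ne_of_valuation_relNorm_lt_one hB hx hR hKI fun b hb =>
      valuation_relNorm_lt_one_of_localIndex hB hR hx hindex hb)
    (fun h => hK (h ▸ le_sup_left))
  rw [numBetween, Set.ncard_eq_one]
  refine ⟨J, Set.eq_singleton_iff_unique_mem.2 ⟨⟨hJ, hJK ▸ le_sup_left⟩, ?_⟩⟩
  rintro J' ⟨hJ', hKJ'⟩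
  refine (heckeSet_eq_of_le v.ne_bot hJ hJ' ?_).symm
  rw [hJK]
  exact sup_le hKJ' (smul_le_of_mem_heckeSet hB hR hJ')

omit hR in
-- In rank four `𝔭I` has index `𝔭⁴` in `I`, which accounts for the two extra factors `𝔭` once
-- squared.
theorem mem_heckeSet_idealMul_iff {𝔪 : Ideal (𝓞 F)} (h𝔪 : 𝔪 ≠ ⊥) {I K : LeftIdeals R} :
    K ∈ heckeSet 𝔪 (I.idealMul v.asIdeal v.ne_bot) ↔
      K ∈ heckeSet (𝔪 * v.asIdeal * v.asIdeal) I ∧ K.1 ≤ v.asIdeal • I.1 := by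
  rw [mem_heckeSet_iff h𝔪, mem_heckeSet_iff (mul_ne_zero (mul_ne_zero h𝔪 v.ne_bot) v.ne_bot)]
  have h : ∀ w, localIndex w (I.idealMul v.asIdeal v.ne_bot) K = idealVal w 𝔪 ^ 2 ↔
      localIndex w I K = idealVal w (𝔪 * v.asIdeal * v.asIdeal) ^ 2 := by
    intro w
    rw [← localIndex_mul w I (I.idealMul v.asIdeal v.ne_bot) K, localIndex_idealMul, hB.finrank_eq,
      idealVal_mul w (mul_ne_zero h𝔪 v.ne_bot) v.ne_bot, idealVal_mul w h𝔪 v.ne_bot]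
    have h1 : (idealVal w 𝔪 * idealVal w v.asIdeal * idealVal w v.asIdeal) ^ 2
        = idealVal w v.asIdeal ^ 4 * idealVal w 𝔪 ^ 2 := by
      rw [mul_pow, mul_pow, mul_assoc, ← pow_add, mul_comm]
    rw [h1]
    exact (mul_right_inj' (pow_ne_zero 4 (idealVal_ne_zero w v.ne_bot))).symm
  simp_rw [h]
  exact ⟨fun h => ⟨⟨h.1.trans Submodule.smul_le_right, h.2⟩, h.1⟩, fun h => ⟨h.2, h.1.2⟩⟩

/-- Every `K` is counted once, and `N(𝔭)` more times exactly when it lies in `𝔭I`. -/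
theorem hecke_mul_hecke_prime (L : LocalBasis v R) {𝔪 : Ideal (𝓞 F)} (h𝔪 : 𝔪 ≠ ⊥) :
    hecke R (𝔪 * v.asIdeal) * hecke R v.asIdeal = hecke R (𝔪 * v.asIdeal * v.asIdeal) +
      (Ideal.absNorm v.asIdeal : ℂ) • (idealAct R v.asIdeal v.ne_bot * hecke R 𝔪) := by
  classical
  have h𝔪v : 𝔪 * v.asIdeal ≠ ⊥ := mul_ne_zero h𝔪 v.ne_bot
  have h𝔪vv : 𝔪 * v.asIdeal * v.asIdeal ≠ ⊥ := mul_ne_zero h𝔪v v.ne_bot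
  refine module_end_ext fun I => ?_
  rw [hecke_mul_hecke_cl h𝔪v v.ne_bot, LinearMap.add_apply, LinearMap.smul_apply,
    idealAct_mul_hecke_cl v.ne_bot h𝔪, hecke_cl R h𝔪vv]
  have h1 : (heckeSet_finite h𝔪 (I.idealMul v.asIdeal v.ne_bot)).toFinset
      = {K ∈ (heckeSet_finite h𝔪vv I).toFinset | K.1 ≤ v.asIdeal • I.1} := by
    ext K
    simp only [Set.Finite.mem_toFinset, Finset.mem_filter]
    exact mem_heckeSet_idealMul_iff hB h𝔪
  rw [h1, Finset.smul_sum, Finset.sum_filter, ← Finset.sum_add_distrib]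
  refine Finset.sum_congr rfl fun K hK => ?_
  rw [Set.Finite.mem_toFinset, mem_heckeSet_iff h𝔪vv] at hK
  split_ifs with hle
  · rw [numBetween_of_le hB hR L hle, Nat.cast_add, Nat.cast_one, add_smul, one_smul, add_comm]
  · have hindex : localIndex v I K < 1 := by
      rw [hK.2]
      exact pow_lt_one' (idealVal_lt_one v Ideal.mul_le_right) two_ne_zero
    rw [numBetween_of_not_le hB hR L hK.1 hindex hle, Nat.cast_one, one_smul, add_zero]

end HeckeRelation

end QuatModForm

theorem proposition2 {F : Type*} [Field F] [NumberField F] {B : Type*} [Ring B] [Algebra F B]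
    (hB : QuatModForm.IsTotallyDefinite F B)
    (R : Subalgebra (𝓞 F) B) (hR : QuatModForm.IsEichlerOrder R)
    (D : Ideal (𝓞 F)) (hD : QuatModForm.IsDiscriminant R D) :
    (∀ m n : Ideal (𝓞 F), m ≠ ⊥ → n ≠ ⊥ → IsCoprime m n →
      QuatModForm.hecke R m * QuatModForm.hecke R n = QuatModForm.hecke R (m * n)) ∧
    (∀ (p : Ideal (𝓞 F)) (_ : p.IsPrime) (hp0 : p ≠ ⊥), ¬ p ∣ D →
      (∀ k : ℕ, QuatModForm.hecke R (p ^ (k + 2)) =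
        QuatModForm.hecke R (p ^ (k + 1)) * QuatModForm.hecke R p -
          (Ideal.absNorm p : ℂ) • (QuatModForm.idealAct R p hp0 * QuatModForm.hecke R (p ^ k))) ∧
      (∀ m m' : Ideal (𝓞 F), m ≠ ⊥ → m = m' * p →
        QuatModForm.hecke R m * QuatModForm.hecke R p =
          QuatModForm.hecke R (m * p) +
            (Ideal.absNorm p : ℂ) • (QuatModForm.idealAct R p hp0 * QuatModForm.hecke R m'))) := by
  have hquat := hB.quaternion
  have := hquat.moduleFinite
  refine ⟨fun m n hm hn h => QuatModForm.hecke_mul_of_isCoprime hm hn h, fun p hp hp0 hpD => ?_⟩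
  let v : IsDedekindDomain.HeightOneSpectrum (𝓞 F) := ⟨p, hp, hp0⟩
  obtain ⟨L⟩ := QuatModForm.exists_localBasis hquat hR.isOrder hD v hpD
  -- Both relations at `p` are this identity, with `p ^ k` and with `m'` in place of `m`.
  have key : ∀ m : Ideal (𝓞 F), m ≠ ⊥ →
      QuatModForm.hecke R (m * p) * QuatModForm.hecke R p = QuatModForm.hecke R (m * p * p) +
        (Ideal.absNorm p : ℂ) • (QuatModForm.idealAct R p hp0 * QuatModForm.hecke R m) := fun m hm =>
    QuatModForm.hecke_mul_hecke_prime hquat hR.isOrder L hm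
  refine ⟨fun k => ?_, fun m m' hm hmm' => ?_⟩
  · rw [pow_succ p (k + 1), pow_succ p k]
    refine LinearMap.ext fun z => ?_
    rw [key _ (pow_ne_zero k hp0), LinearMap.sub_apply, LinearMap.add_apply, add_sub_cancel_right]
  · subst hmm'
    exact key m' fun h => hm (by rw [h, Ideal.bot_mul])
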